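/- Let $f:\mathbb{R}\to\mathbb{R}$ be a strictly positive continuous function with $\int_{\mathbb{R}} f(a)\,da=1$, and put $d\nu=f\,da$. Equip $\mathbb{R}^{\mathbb{N}}$ with the metric $d(x,y)=\sum_{n\ge 1}\frac{1}{\pi 2^n}|\arctan x_n-\arctan y_n|$, write $ax=(a,x_1,x_2,\dots)$ for $a\in\mathbb{R}$ and $x \in \mathbb{R}^{\mathbb{N}}$, let $\sigma(x_1,x_2,\dots)=(x_2,x_3,\dots)$ be the shift, and let $\mathcal{M}_\sigma$ be the set of $\sigma$-invariant Borel probability measures on $\mathbb{R}^{\mathbb{N}}$. For a potential $B:\mathbb{R}^{\mathbb{N}}\to\mathbb{R}$ let $\mathcal{L}_B\varphi(x)=\int_{\mathbb{R}} e^{B(ax)}\varphi(ax)\,d\nu(a)$ be the Ruelle operator, with dual $\mathcal{L}_B^*$ given by $\int\varphi\,d(\mathcal{L}_B^*\mu)=\int\mathcal{L}_B\varphi\,d\mu$ for bounded continuous $\varphi$. For $\mu\in\mathcal{M}_\sigma$ define the entropy $$h(\mu)=\inf_{u}\int_{\mathbb{R}^{\mathbb{N}}}\log\Big(\frac{\mathcal{L}_0u}{u}\Big)\,d\mu\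 \in[-\infty,0],$$ the infimum being over all strictly positive bounded continuous $u:\mathbb{R}^{\mathbb{N}}\to\mathbb{R}$ for which the integral exists in $[-\infty,\infty]$. Let $\alpha>0$ and let $A:\mathbb{R}^{\mathbb{N}}\to\mathbb{R}$ be $\alpha$-Hölder continuous with respect to $d$. Then: (i) There is exactly one $\lambda_A>0$, the maximal eigenvalue of $\mathcal{L}_A$, such that $\mathcal{L}_A\psi=\lambda_A\psi$ for some strictly positive $\alpha$-Hölder function $\psi$ and such that $|c|\le\lambda_A$ for every real eigenvalue $c$ of $\mathcal{L}_A$ on bounded continuous functions. (ii) There is exactly one $\mu_A\in\mathcal{M}_\sigma$, the Gibbs state of $A$, such that $\mathcal{L}_{\bar A}^*\mu_A=\mu_A$ with $\bar A=A+\log\psi_A-\log(\psi_A\circ\sigma)-\log\lambda_A$ for some strictly positive $\alpha$-Hölder eigenfunction $\psi_A$ of $\mathcal{L}_A$ with eigenvalue $\lambda_A$. (iii) One has $$\log\lambda_A=\sup_{\mu\in\mathcal{M}_\sigma}\Big\{h(\mu)+\int_{\mathbb{R}^{\mathbb{N}}}A\,d\mu\Big\},$$ and the supremum is attained at $\mu_A$.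 -/

import Mathlib

open MeasureTheory
open scoped BoundedContinuousFunction

noncomputable section

namespace Ruelle

/-- The distance `d(x, y) = ∑_{n ≥ 1} |arctan x_n - arctan y_n| / (π 2^n)` on real sequences;
the Lean index `n` stands for the coordinate number `n + 1`. It induces the product topology. -/
def seqDist (x y : ℕ → ℝ) : ℝ :=
  ∑' n : ℕ, 1 / (Real.pi * 2 ^ (n + 1)) * |Real.arctan (x n) - Real.arctan (y n)|

/-- `α`-Hölder continuity with respect to `seqDist`. -/
def IsHolder (α : ℝ) (A : (ℕ → ℝ) → ℝ) : Prop :=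
  ∃ C : ℝ, ∀ x y : ℕ → ℝ, |A x - A y| ≤ C * seqDist x y ^ α

/-- The shift `σ (x₁, x₂, …) = (x₂, x₃, …)`. -/
def shift (x : ℕ → ℝ) : ℕ → ℝ := fun n => x (n + 1)

/-- The sequence `a x = (a, x₁, x₂, …)`. -/
def prepend (a : ℝ) (x : ℕ → ℝ) : ℕ → ℝ
  | 0 => a
  | n + 1 => x n

/-- The a priori measure `dν = f da`. -/
def apriori (f : ℝ → ℝ) : Measure ℝ :=
  volume.withDensity (fun a => ENNReal.ofReal (f a))

/-- The Ruelle operator `L_A φ (x) = ∫ exp (A (a x)) φ (a x) dν(a)`. -/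
def ruelleOp (f : ℝ → ℝ) (A φ : (ℕ → ℝ) → ℝ) (x : ℕ → ℝ) : ℝ :=
  ∫ a, Real.exp (A (prepend a x)) * φ (prepend a x) ∂(apriori f)

/-- `lam > 0` is an eigenvalue of `L_A` with eigenfunction `ψ`, strictly positive and
`α`-Hölder. -/
structure IsPositiveEigenpair (f : ℝ → ℝ) (α : ℝ) (A : (ℕ → ℝ) → ℝ) (lam : ℝ)
    (ψ : (ℕ → ℝ) → ℝ) : Prop where
  eigenvalue_pos : 0 < lam
  holder : IsHolder α ψ
  pos : ∀ x, 0 < ψ x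
  eigen : ∀ x, ruelleOp f A ψ x = lam * ψ x

/-- `lam` is the maximal eigenvalue of `L_A`: it has a strictly positive `α`-Hölder
eigenfunction, and every eigenvalue of `L_A` on bounded continuous functions has modulus at
most `lam`. -/
structure IsMaximalEigenvalue (f : ℝ → ℝ) (α : ℝ) (A : (ℕ → ℝ) → ℝ) (lam : ℝ) : Prop where
  exists_eigenfunction : ∃ ψ : (ℕ → ℝ) → ℝ, IsPositiveEigenpair f α A lam ψ
  maximal : ∀ (c : ℝ) (φ : (ℕ → ℝ) →ᵇ ℝ), φ ≠ 0 →
    (∀ x, ruelleOp f A φ x = c * φ x) → |c| ≤ lam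

/-- The normalized potential `A + log ψ - log (ψ ∘ σ) - log lam`. -/
def normalized (A : (ℕ → ℝ) → ℝ) (lam : ℝ) (ψ : (ℕ → ℝ) → ℝ) (x : ℕ → ℝ) : ℝ :=
  A x + Real.log (ψ x) - Real.log (ψ (shift x)) - Real.log lam

/-- Shift-invariant Borel probability measures on the space of real sequences. -/
structure IsInvariantProb (μ : Measure (ℕ → ℝ)) : Prop where
  prob : IsProbabilityMeasure μ
  invariant : μ.map shift = μ

/-- `μ` is a fixed point of the dual operator `L_B^*`, defined by
`∫ φ d(L_B^* μ) = ∫ L_B φ dμ` for bounded continuous `φ`. -/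
def IsDualFixed (f : ℝ → ℝ) (B : (ℕ → ℝ) → ℝ) (μ : Measure (ℕ → ℝ)) : Prop :=
  ∀ φ : (ℕ → ℝ) →ᵇ ℝ, ∫ x, φ x ∂μ = ∫ x, ruelleOp f B φ x ∂μ

/-- `μ` is a Gibbs state for `A`: a shift-invariant probability measure fixed by the dual of the
Ruelle operator of the normalized potential, for the maximal eigenvalue of `L_A` and a strictly
positive `α`-Hölder eigenfunction of it. -/
def IsGibbsState (f : ℝ → ℝ) (α : ℝ) (A : (ℕ → ℝ) → ℝ) (μ : Measure (ℕ → ℝ)) : Prop :=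
  IsInvariantProb μ ∧ ∃ (lam : ℝ) (ψ : (ℕ → ℝ) → ℝ), IsMaximalEigenvalue f α A lam ∧
    IsPositiveEigenpair f α A lam ψ ∧ IsDualFixed f (normalized A lam ψ) μ

/-- The integral of `g` exists in `[-∞, ∞]`: its positive or its negative part has finite
integral. -/
def HasExtIntegral (μ : Measure (ℕ → ℝ)) (g : (ℕ → ℝ) → ℝ) : Prop :=
  ∫⁻ x, ENNReal.ofReal (g x) ∂μ ≠ ⊤ ∨ ∫⁻ x, ENNReal.ofReal (-g x) ∂μ ≠ ⊤

/-- The integral of `g` as an element of `[-∞, ∞]`, meaningful under `HasExtIntegral μ g`. -/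
def extIntegral (μ : Measure (ℕ → ℝ)) (g : (ℕ → ℝ) → ℝ) : EReal :=
  ((∫⁻ x, ENNReal.ofReal (g x) ∂μ : ENNReal) : EReal) -
    ((∫⁻ x, ENNReal.ofReal (-g x) ∂μ : ENNReal) : EReal)

/-- `log (L_0 u / u)`, where `L_0` is the Ruelle operator of the zero potential. -/
def logRatio (f : ℝ → ℝ) (u : (ℕ → ℝ) → ℝ) (x : ℕ → ℝ) : ℝ :=
  Real.log (ruelleOp f (fun _ => 0) u x / u x)

/-- The entropy `h(μ) = inf_u ∫ log (L_0 u / u) dμ`, an element of `[-∞, ∞]`, the infimum being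
over the strictly positive bounded continuous `u` for which the integral exists in `[-∞, ∞]`. -/
def entropy (f : ℝ → ℝ) (μ : Measure (ℕ → ℝ)) : EReal :=
  ⨅ (u : (ℕ → ℝ) →ᵇ ℝ) (_ : ∀ x, 0 < u x) (_ : HasExtIntegral μ (logRatio f u)),
    extIntegral μ (logRatio f u)

end Ruelle

end

namespace Ruelle

open Filter Topology

/-! ### The distance on sequences -/

/-! Prepending a coordinate halves the distance. If `A` has Hölder constant `C`, the Ruelle operator
therefore turns a positive function whose logarithm has Hölder constant `K` into one with constant
`(C + K) * 2 ^ (-α)`. For large `K` the cone `InCone α K` is thus mapped into itself, and even the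
cone of constant `K + 1` is mapped into it. This margin yields a contraction: given `φ` and `g` in
the cone, a fixed proportion of `φ` can be split off as a multiple of `g`, and the remainder returns
to the cone after one application (`InCone.exists_contraction_step`). Iterating makes the images of
`φ` and `g` proportional at a geometric rate (`InCone.exists_iterate_bounds`), an elementary form of
Birkhoff's contraction theorem.

Everything spectral follows from this. The iterates of `1`, normalized at one point, converge to a
positive eigenfunction (`exists_inCone_eigenfunction`), and comparison with that eigenfunction
bounds every other eigenvalue (`isMaximalEigenvalue_of_inCone`). For the normalized potential `1` is
fixed, so the iterates of a Hölder function lose their oscillation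
(`exists_tendsto_zero_abs_iterate_sub_le`). Hence the normalized potential does not depend on the
eigenfunction and the dual operator has at most one fixed probability measure. One exists as a
cluster point of the dual iterates of a Dirac mass, which are tight.

For the variational principle, invariance gives `∫ normalized A lam ψ = ∫ A - log lam`, so the claim
is that the entropy is at most minus the integral of the normalized potential `B`, with equality at
the Gibbs state. The test function `exp B` gives the inequality (`entropy_le_neg_integral`). The
reverse inequality at the Gibbs state is Jensen's inequality for the operator of `B`, which averages
against probability measures (`IsDualFixed.neg_integral_le_entropy`). -/

lemma seqDist_term_nonneg (x y : ℕ → ℝ) (n : ℕ) :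
    0 ≤ 1 / (Real.pi * 2 ^ (n + 1)) * |Real.arctan (x n) - Real.arctan (y n)| := by
  have := Real.pi_pos
  positivity

lemma seqDist_term_le (x y : ℕ → ℝ) (n : ℕ) :
    1 / (Real.pi * 2 ^ (n + 1)) * |Real.arctan (x n) - Real.arctan (y n)| ≤
      1 / 2 / 2 ^ n := by
  have hpi := Real.pi_pos
  have h : |Real.arctan (x n) - Real.arctan (y n)| ≤ Real.pi := by
    rw [abs_le]
    constructor <;>
      linarith [Real.arctan_lt_pi_div_two (x n), Real.arctan_lt_pi_div_two (y n),
        Real.neg_pi_div_two_lt_arctan (x n), Real.neg_pi_div_two_lt_arctan (y n)]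
  calc 1 / (Real.pi * 2 ^ (n + 1)) * |Real.arctan (x n) - Real.arctan (y n)|
      ≤ 1 / (Real.pi * 2 ^ (n + 1)) * Real.pi := by gcongr
    _ = 1 / 2 / 2 ^ n := by field_simp; ring

lemma seqDist_summable (x y : ℕ → ℝ) :
    Summable fun n : ℕ =>
      1 / (Real.pi * 2 ^ (n + 1)) * |Real.arctan (x n) - Real.arctan (y n)| :=
  Summable.of_nonneg_of_le (seqDist_term_nonneg x y) (seqDist_term_le x y)
    (summable_geometric_two' 1)

lemma seqDist_nonneg (x y : ℕ → ℝ) : 0 ≤ seqDist x y :=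
  tsum_nonneg (seqDist_term_nonneg x y)

lemma seqDist_le_one (x y : ℕ → ℝ) : seqDist x y ≤ 1 := by
  have := (seqDist_summable x y).tsum_le_tsum (seqDist_term_le x y) (summable_geometric_two' 1)
  rwa [tsum_geometric_two'] at this

lemma seqDist_self (x : ℕ → ℝ) : seqDist x x = 0 := by simp [seqDist]

lemma seqDist_comm (x y : ℕ → ℝ) : seqDist x y = seqDist y x := by
  simp only [seqDist, abs_sub_comm]

lemma seqDist_eq_head_add (x y : ℕ → ℝ) :
    seqDist x y = 1 / (2 * Real.pi) * |Real.arctan (x 0) - Real.arctan (y 0)| +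
      seqDist (shift x) (shift y) / 2 := by
  have hpi := Real.pi_pos
  unfold seqDist
  rw [(seqDist_summable x y).tsum_eq_zero_add, ← tsum_div_const]
  congr 1
  · ring_nf
  · refine tsum_congr fun n => ?_
    simp only [shift]
    field_simp
    ring

/-- The equal heads cancel and the tail moves one place down the geometric weights. This is the
source of all contraction below. -/
lemma seqDist_prepend (a : ℝ) (x y : ℕ → ℝ) :
    seqDist (prepend a x) (prepend a y) = seqDist x y / 2 := by
  rw [seqDist_eq_head_add]
  have h : ∀ z : ℕ → ℝ, shift (prepend a z) = z := fun z => rfl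
  simp [h, prepend]

lemma seqDist_shift_le (x y : ℕ → ℝ) : seqDist (shift x) (shift y) ≤ 2 * seqDist x y := by
  have hpi := Real.pi_pos
  have : 0 ≤ 1 / (2 * Real.pi) * |Real.arctan (x 0) - Real.arctan (y 0)| := by positivity
  linarith [seqDist_eq_head_add x y]

lemma abs_arctan_sub_le (x y : ℕ → ℝ) (n : ℕ) :
    |Real.arctan (x n) - Real.arctan (y n)| ≤ Real.pi * 2 ^ (n + 1) * seqDist x y := by
  have hpi := Real.pi_pos
  have h := (seqDist_summable x y).le_tsum n fun j _ => seqDist_term_nonneg x y j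
  change _ ≤ seqDist x y at h
  calc |Real.arctan (x n) - Real.arctan (y n)|
      = Real.pi * 2 ^ (n + 1) *
        (1 / (Real.pi * 2 ^ (n + 1)) * |Real.arctan (x n) - Real.arctan (y n)|) := by
        field_simp
    _ ≤ _ := by gcongr

lemma continuous_seqDist (y : ℕ → ℝ) : Continuous fun x => seqDist x y := by
  unfold seqDist
  refine continuous_tsum (fun n => ?_) (summable_geometric_two' 1) fun n x => ?_
  · have := Real.continuous_arctan
    fun_prop
  · rw [Real.norm_of_nonneg (seqDist_term_nonneg x y n)]
    exact seqDist_term_le x y n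

lemma seqDist_rpow_nonneg (α : ℝ) (x y : ℕ → ℝ) : 0 ≤ seqDist x y ^ α :=
  Real.rpow_nonneg (seqDist_nonneg x y) α

lemma seqDist_rpow_le_one {α : ℝ} (hα : 0 < α) (x y : ℕ → ℝ) : seqDist x y ^ α ≤ 1 :=
  Real.rpow_le_one (seqDist_nonneg x y) (seqDist_le_one x y) hα.le

lemma seqDist_rpow_prepend (α a : ℝ) (x y : ℕ → ℝ) :
    seqDist (prepend a x) (prepend a y) ^ α = (2 : ℝ) ^ (-α) * seqDist x y ^ α := by
  rw [seqDist_prepend, div_eq_mul_inv, Real.mul_rpow (seqDist_nonneg x y) (by norm_num),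
    Real.inv_rpow (by norm_num), Real.rpow_neg (by norm_num), mul_comm]

lemma seqDist_rpow_shift_le {α : ℝ} (hα : 0 < α) (x y : ℕ → ℝ) :
    seqDist (shift x) (shift y) ^ α ≤ (2 : ℝ) ^ α * seqDist x y ^ α := by
  rw [← Real.mul_rpow (by norm_num) (seqDist_nonneg x y)]
  exact Real.rpow_le_rpow (seqDist_nonneg _ _) (seqDist_shift_le x y) hα.le

/-! ### The maps `prepend` and `shift` -/

lemma shift_prepend (a : ℝ) (x : ℕ → ℝ) : shift (prepend a x) = x := rfl

lemma continuous_shift : Continuous shift :=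
  continuous_pi fun n => continuous_apply (n + 1)

lemma continuous_prepend : Continuous fun p : ℝ × (ℕ → ℝ) => prepend p.1 p.2 :=
  continuous_pi fun n => by
    cases n with
    | zero => exact continuous_fst
    | succ n => exact (continuous_apply n).comp continuous_snd

lemma continuous_prepend_left (x : ℕ → ℝ) : Continuous fun a => prepend a x :=
  continuous_prepend.comp (Continuous.prodMk_left x)

lemma continuous_prepend_right (a : ℝ) : Continuous fun x => prepend a x :=
  continuous_prepend.comp (Continuous.prodMk_right a)

/-! ### Hölder functions -/

lemma IsHolder.exists_nonneg {α : ℝ} {A : (ℕ → ℝ) → ℝ} (h : IsHolder α A) :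
    ∃ C : ℝ, 0 ≤ C ∧ ∀ x y : ℕ → ℝ, |A x - A y| ≤ C * seqDist x y ^ α := by
  obtain ⟨C, hC⟩ := h
  refine ⟨max C 0, le_max_right _ _, fun x y => (hC x y).trans ?_⟩
  exact mul_le_mul_of_nonneg_right (le_max_left _ _) (seqDist_rpow_nonneg α x y)

lemma IsHolder.continuous {α : ℝ} (hα : 0 < α) {A : (ℕ → ℝ) → ℝ} (h : IsHolder α A) :
    Continuous A := by
  obtain ⟨C, hC⟩ := h
  refine continuous_iff_continuousAt.2 fun y => ?_
  rw [ContinuousAt, tendsto_iff_dist_tendsto_zero]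
  refine squeeze_zero (fun _ => dist_nonneg) (fun x => hC x y) ?_
  have h1 : Continuous fun x => C * seqDist x y ^ α :=
    continuous_const.mul ((continuous_seqDist y).rpow_const fun _ => Or.inr hα.le)
  have h2 := h1.tendsto y
  simpa [seqDist_self, Real.zero_rpow hα.ne'] using h2

lemma IsHolder.exists_bound {α : ℝ} (hα : 0 < α) {A : (ℕ → ℝ) → ℝ} (h : IsHolder α A) :
    ∃ C : ℝ, ∀ x, |A x| ≤ C := by
  obtain ⟨C, hC0, hC⟩ := h.exists_nonneg
  refine ⟨|A 0| + C, fun x => ?_⟩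
  have h1 : |A x - A 0| ≤ C :=
    (hC x 0).trans (mul_le_of_le_one_right hC0 (seqDist_rpow_le_one hα x 0))
  have h2 := abs_add_le (A 0) (A x - A 0)
  rw [add_sub_cancel] at h2
  linarith

/-- The distance never exceeds 1, so lowering the exponent only enlarges the bound. -/
lemma IsHolder.mono {α β : ℝ} (hβ : 0 < β) (hβα : β ≤ α) {A : (ℕ → ℝ) → ℝ}
    (h : IsHolder α A) : IsHolder β A := by
  obtain ⟨C, hC0, hC⟩ := h.exists_nonneg
  refine ⟨C, fun x y => (hC x y).trans (mul_le_mul_of_nonneg_left ?_ hC0)⟩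
  rcases (seqDist_nonneg x y).eq_or_lt with h0 | h0
  · rw [← h0, Real.zero_rpow hβ.ne', Real.zero_rpow (hβ.trans_le hβα).ne']
  · exact Real.rpow_le_rpow_of_exponent_ge h0 (seqDist_le_one x y) hβα

lemma isHolder_const (α c : ℝ) : IsHolder α fun _ => c := ⟨0, fun x y => by simp⟩

lemma IsHolder.add {α : ℝ} {A B : (ℕ → ℝ) → ℝ} (hA : IsHolder α A) (hB : IsHolder α B) :
    IsHolder α fun x => A x + B x := by
  obtain ⟨C, hC⟩ := hA
  obtain ⟨C', hC'⟩ := hB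
  refine ⟨C + C', fun x y => ?_⟩
  have h := abs_add_le (A x - A y) (B x - B y)
  rw [show A x + B x - (A y + B y) = A x - A y + (B x - B y) by ring, add_mul]
  linarith [hC x y, hC' x y]

lemma IsHolder.mul {α : ℝ} (hα : 0 < α) {A B : (ℕ → ℝ) → ℝ} (hA : IsHolder α A)
    (hB : IsHolder α B) : IsHolder α fun x => A x * B x := by
  obtain ⟨M, hM⟩ := hA.exists_bound hα
  obtain ⟨M', hM'⟩ := hB.exists_bound hα
  obtain ⟨C, hC⟩ := hA
  obtain ⟨C', hC'⟩ := hB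
  refine ⟨M * C' + M' * C, fun x y => ?_⟩
  have h := abs_add_le (A x * (B x - B y)) (B y * (A x - A y))
  rw [show A x * B x - A y * B y = A x * (B x - B y) + B y * (A x - A y) by ring]
  rw [abs_mul, abs_mul] at h
  have h1 : |A x| * |B x - B y| ≤ M * (C' * seqDist x y ^ α) :=
    mul_le_mul (hM x) (hC' x y) (abs_nonneg _) ((abs_nonneg _).trans (hM x))
  have h2 : |B y| * |A x - A y| ≤ M' * (C * seqDist x y ^ α) :=
    mul_le_mul (hM' y) (hC x y) (abs_nonneg _) ((abs_nonneg _).trans (hM' y))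
  linarith

lemma IsHolder.const_mul {α : ℝ} (hα : 0 < α) (c : ℝ) {A : (ℕ → ℝ) → ℝ} (hA : IsHolder α A) :
    IsHolder α fun x => c * A x :=
  (isHolder_const α c).mul hα hA

lemma IsHolder.sub {α : ℝ} (hα : 0 < α) {A B : (ℕ → ℝ) → ℝ} (hA : IsHolder α A)
    (hB : IsHolder α B) : IsHolder α fun x => A x - B x := by
  have h := hA.add (hB.const_mul hα (-1))
  simpa [sub_eq_add_neg] using h

lemma IsHolder.comp_shift {α : ℝ} (hα : 0 < α) {A : (ℕ → ℝ) → ℝ} (hA : IsHolder α A) :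
    IsHolder α fun x => A (shift x) := by
  obtain ⟨C, hC0, hC⟩ := hA.exists_nonneg
  refine ⟨C * 2 ^ α, fun x y => (hC _ _).trans ?_⟩
  rw [mul_assoc]
  exact mul_le_mul_of_nonneg_left (seqDist_rpow_shift_le hα x y) hC0

/-- These functions separate points. The restriction `α ≤ 1` matters: each one is Lipschitz but not
Hölder of any larger exponent. -/
lemma isHolder_arctan_apply {α : ℝ} (hα : 0 < α) (hα1 : α ≤ 1) (n : ℕ) :
    IsHolder α fun x => Real.arctan (x n) := by
  refine IsHolder.mono (α := 1) hα hα1 ⟨Real.pi * 2 ^ (n + 1), fun x y => ?_⟩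
  simpa using abs_arctan_sub_le x y n

/-! ### The Ruelle operator on bounded continuous functions -/

/-- Continuous and bounded. -/
def IsBddCont (φ : (ℕ → ℝ) → ℝ) : Prop := Continuous φ ∧ ∃ C : ℝ, ∀ x, |φ x| ≤ C

lemma IsHolder.isBddCont {α : ℝ} (hα : 0 < α) {A : (ℕ → ℝ) → ℝ} (h : IsHolder α A) :
    IsBddCont A := ⟨h.continuous hα, h.exists_bound hα⟩

lemma isBddCont_const (c : ℝ) : IsBddCont fun _ => c := ⟨continuous_const, |c|, fun _ => le_rfl⟩

lemma isBddCont_coe (φ : (ℕ → ℝ) →ᵇ ℝ) : IsBddCont φ :=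
  ⟨φ.continuous, ‖φ‖, fun x => φ.norm_coe_le_norm x⟩

lemma IsBddCont.exists_coe {φ : (ℕ → ℝ) → ℝ} (h : IsBddCont φ) :
    ∃ Φ : (ℕ → ℝ) →ᵇ ℝ, ⇑Φ = φ := by
  obtain ⟨C, hC⟩ := h.2
  exact ⟨BoundedContinuousFunction.ofNormedAddCommGroup φ h.1 C hC, rfl⟩

lemma IsBddCont.add {φ ψ : (ℕ → ℝ) → ℝ} (hφ : IsBddCont φ) (hψ : IsBddCont ψ) :
    IsBddCont fun x => φ x + ψ x := by
  obtain ⟨C, hC⟩ := hφ.2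
  obtain ⟨C', hC'⟩ := hψ.2
  exact ⟨hφ.1.add hψ.1, C + C', fun x => (abs_add_le _ _).trans (add_le_add (hC x) (hC' x))⟩

lemma IsBddCont.mul {φ ψ : (ℕ → ℝ) → ℝ} (hφ : IsBddCont φ) (hψ : IsBddCont ψ) :
    IsBddCont fun x => φ x * ψ x := by
  obtain ⟨C, hC⟩ := hφ.2
  obtain ⟨C', hC'⟩ := hψ.2
  refine ⟨hφ.1.mul hψ.1, C * C', fun x => ?_⟩
  rw [abs_mul]
  exact mul_le_mul (hC x) (hC' x) (abs_nonneg _) ((abs_nonneg _).trans (hC x))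

lemma IsBddCont.const_mul {φ : (ℕ → ℝ) → ℝ} (c : ℝ) (hφ : IsBddCont φ) :
    IsBddCont fun x => c * φ x := (isBddCont_const c).mul hφ

lemma IsBddCont.neg {φ : (ℕ → ℝ) → ℝ} (hφ : IsBddCont φ) : IsBddCont fun x => -φ x := by
  simpa using hφ.const_mul (-1)

lemma IsBddCont.sub {φ ψ : (ℕ → ℝ) → ℝ} (hφ : IsBddCont φ) (hψ : IsBddCont ψ) :
    IsBddCont fun x => φ x - ψ x := by
  simpa [sub_eq_add_neg] using hφ.add hψ.neg

lemma IsBddCont.abs {φ : (ℕ → ℝ) → ℝ} (hφ : IsBddCont φ) : IsBddCont fun x => |φ x| := by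
  obtain ⟨C, hC⟩ := hφ.2
  exact ⟨hφ.1.abs, C, fun x => by simpa using hC x⟩

lemma IsBddCont.exp {φ : (ℕ → ℝ) → ℝ} (hφ : IsBddCont φ) :
    IsBddCont fun x => Real.exp (φ x) := by
  obtain ⟨C, hC⟩ := hφ.2
  refine ⟨Real.continuous_exp.comp hφ.1, Real.exp C, fun x => ?_⟩
  rw [Real.abs_exp]
  exact Real.exp_le_exp.2 ((le_abs_self _).trans (hC x))

lemma IsBddCont.comp {φ : (ℕ → ℝ) → ℝ} (hφ : IsBddCont φ) {g : (ℕ → ℝ) → ℕ → ℝ}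
    (hg : Continuous g) : IsBddCont fun x => φ (g x) := by
  obtain ⟨C, hC⟩ := hφ.2
  exact ⟨hφ.1.comp hg, C, fun x => hC _⟩

lemma IsBddCont.integrable {φ : (ℕ → ℝ) → ℝ} (hφ : IsBddCont φ) (μ : Measure (ℕ → ℝ))
    [IsFiniteMeasure μ] : Integrable φ μ := by
  obtain ⟨C, hC⟩ := hφ.2
  exact Integrable.of_bound hφ.1.aestronglyMeasurable C (ae_of_all _ hC)

lemma isProbabilityMeasure_apriori {f : ℝ → ℝ} (hf_pos : ∀ a, 0 < f a)
    (hf_int : ∫ a, f a = 1) : IsProbabilityMeasure (apriori f) := by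
  constructor
  have hi : Integrable f := by
    by_contra h
    rw [integral_undef h] at hf_int
    exact zero_ne_one hf_int
  rw [apriori, withDensity_apply _ MeasurableSet.univ, Measure.restrict_univ,
    ← ofReal_integral_eq_lintegral_ofReal hi (ae_of_all _ fun a => (hf_pos a).le), hf_int,
    ENNReal.ofReal_one]

lemma ruelleOp_const_mul {f : ℝ → ℝ} {A : (ℕ → ℝ) → ℝ} (c : ℝ)
    (φ : (ℕ → ℝ) → ℝ) (x : ℕ → ℝ) :
    ruelleOp f A (fun y => c * φ y) x = c * ruelleOp f A φ x := by
  unfold ruelleOp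
  rw [← integral_const_mul]
  congr 1 with a
  ring

lemma abs_ruelleOp_le {f : ℝ → ℝ} {A : (ℕ → ℝ) → ℝ} (φ : (ℕ → ℝ) → ℝ)
    (x : ℕ → ℝ) :
    |ruelleOp f A φ x| ≤ ruelleOp f A (fun y => |φ y|) x := by
  refine (abs_integral_le_integral_abs).trans_eq ?_
  unfold ruelleOp
  congr 1 with a
  rw [abs_mul, Real.abs_exp]

lemma ruelleOp_iterate_const_mul {f : ℝ → ℝ} {A : (ℕ → ℝ) → ℝ} (c : ℝ)
    (φ : (ℕ → ℝ) → ℝ) (n : ℕ) (x : ℕ → ℝ) :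
    (ruelleOp f A)^[n] (fun y => c * φ y) x = c * (ruelleOp f A)^[n] φ x := by
  induction n generalizing φ with
  | zero => rfl
  | succ n ih =>
    rw [Function.iterate_succ_apply, Function.iterate_succ_apply, ← ih,
      show ruelleOp f A (fun y => c * φ y) = fun y => c * ruelleOp f A φ y from
        funext (ruelleOp_const_mul c φ)]

section Operator

variable {f : ℝ → ℝ} [IsProbabilityMeasure (apriori f)] {A : (ℕ → ℝ) → ℝ}

lemma IsBddCont.integrable_prepend {φ : (ℕ → ℝ) → ℝ} (hφ : IsBddCont φ) (x : ℕ → ℝ) :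
    Integrable (fun a => φ (prepend a x)) (apriori f) := by
  obtain ⟨C, hC⟩ := hφ.2
  exact Integrable.of_bound (hφ.1.comp (continuous_prepend_left x)).aestronglyMeasurable C
    (ae_of_all _ fun a => hC _)

lemma integrable_ruelleOp (hA : IsBddCont A) {φ : (ℕ → ℝ) → ℝ} (hφ : IsBddCont φ) (x : ℕ → ℝ) :
    Integrable (fun a => Real.exp (A (prepend a x)) * φ (prepend a x)) (apriori f) :=
  (hA.exp.mul hφ).integrable_prepend x

lemma IsBddCont.integral_prepend {φ : (ℕ → ℝ) → ℝ} (hφ : IsBddCont φ) :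
    IsBddCont fun x => ∫ a, φ (prepend a x) ∂(apriori f) := by
  obtain ⟨C, hC⟩ := hφ.2
  constructor
  · refine continuous_of_dominated (bound := fun _ => C) (fun x => ?_) (fun x => ?_)
      (integrable_const C) (ae_of_all _ fun a => ?_)
    · exact (hφ.1.comp (continuous_prepend_left x)).aestronglyMeasurable
    · exact ae_of_all _ fun a => hC _
    · exact hφ.1.comp (continuous_prepend_right a)
  · refine ⟨C, fun x => ?_⟩
    have h := norm_integral_le_of_norm_le_const (μ := apriori f)
      (f := fun a => φ (prepend a x)) (C := C) (ae_of_all _ fun a => hC _)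
    simpa using h

lemma IsBddCont.ruelleOp (hA : IsBddCont A) {φ : (ℕ → ℝ) → ℝ} (hφ : IsBddCont φ) :
    IsBddCont (ruelleOp f A φ) :=
  (hA.exp.mul hφ).integral_prepend

lemma ruelleOp_add (hA : IsBddCont A) {φ ψ : (ℕ → ℝ) → ℝ} (hφ : IsBddCont φ)
    (hψ : IsBddCont ψ) (x : ℕ → ℝ) :
    ruelleOp f A (fun y => φ y + ψ y) x = ruelleOp f A φ x + ruelleOp f A ψ x := by
  unfold ruelleOp
  rw [← integral_add (integrable_ruelleOp hA hφ x) (integrable_ruelleOp hA hψ x)]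
  congr 1 with a
  ring

lemma ruelleOp_sub (hA : IsBddCont A) {φ ψ : (ℕ → ℝ) → ℝ} (hφ : IsBddCont φ)
    (hψ : IsBddCont ψ) (x : ℕ → ℝ) :
    ruelleOp f A (fun y => φ y - ψ y) x = ruelleOp f A φ x - ruelleOp f A ψ x := by
  unfold ruelleOp
  rw [← integral_sub (integrable_ruelleOp hA hφ x) (integrable_ruelleOp hA hψ x)]
  congr 1 with a
  ring

lemma ruelleOp_mono (hA : IsBddCont A) {φ ψ : (ℕ → ℝ) → ℝ} (hφ : IsBddCont φ)
    (hψ : IsBddCont ψ) (h : ∀ x, φ x ≤ ψ x) (x : ℕ → ℝ) :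
    ruelleOp f A φ x ≤ ruelleOp f A ψ x :=
  integral_mono (integrable_ruelleOp hA hφ x) (integrable_ruelleOp hA hψ x) fun _ =>
    mul_le_mul_of_nonneg_left (h _) (Real.exp_pos _).le

lemma ruelleOp_pos (hA : IsBddCont A) {φ : (ℕ → ℝ) → ℝ} (hφ : IsBddCont φ)
    (h : ∀ x, 0 < φ x) (x : ℕ → ℝ) : 0 < ruelleOp f A φ x := by
  unfold ruelleOp
  have hpos : ∀ a, 0 < Real.exp (A (prepend a x)) * φ (prepend a x) :=
    fun a => mul_pos (Real.exp_pos _) (h _)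
  rw [integral_pos_iff_support_of_nonneg (fun a => (hpos a).le) (integrable_ruelleOp hA hφ x)]
  have : Function.support (fun a => Real.exp (A (prepend a x)) * φ (prepend a x)) = Set.univ :=
    Set.eq_univ_of_forall fun a => (hpos a).ne'
  rw [this, measure_univ]
  exact one_pos

lemma IsBddCont.ruelleOp_iterate (hA : IsBddCont A) {φ : (ℕ → ℝ) → ℝ} (hφ : IsBddCont φ)
    (n : ℕ) : IsBddCont ((Ruelle.ruelleOp f A)^[n] φ) := by
  induction n with
  | zero => exact hφ
  | succ n ih => rw [Function.iterate_succ_apply']; exact hA.ruelleOp ih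

lemma ruelleOp_iterate_mono (hA : IsBddCont A) {φ ψ : (ℕ → ℝ) → ℝ} (hφ : IsBddCont φ)
    (hψ : IsBddCont ψ) (h : ∀ x, φ x ≤ ψ x) (n : ℕ) (x : ℕ → ℝ) :
    (ruelleOp f A)^[n] φ x ≤ (ruelleOp f A)^[n] ψ x := by
  induction n generalizing x with
  | zero => exact h x
  | succ n ih =>
    rw [Function.iterate_succ_apply', Function.iterate_succ_apply']
    exact ruelleOp_mono hA (hA.ruelleOp_iterate hφ n) (hA.ruelleOp_iterate hψ n) ih x

lemma ruelleOp_iterate_add (hA : IsBddCont A) {φ ψ : (ℕ → ℝ) → ℝ} (hφ : IsBddCont φ)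
    (hψ : IsBddCont ψ) (n : ℕ) (x : ℕ → ℝ) :
    (ruelleOp f A)^[n] (fun y => φ y + ψ y) x =
      (ruelleOp f A)^[n] φ x + (ruelleOp f A)^[n] ψ x := by
  induction n generalizing x with
  | zero => rfl
  | succ n ih =>
    simp only [Function.iterate_succ_apply']
    rw [funext ih]
    exact ruelleOp_add hA (hA.ruelleOp_iterate hφ n) (hA.ruelleOp_iterate hψ n) x

end Operator

/-! ### The cone of functions with Hölder logarithm -/

/-- Strictly positive functions whose logarithm is `α`-Hölder with constant `K`. -/
structure InCone (α K : ℝ) (φ : (ℕ → ℝ) → ℝ) : Prop where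
  pos : ∀ x, 0 < φ x
  le : ∀ x y, φ x ≤ Real.exp (K * seqDist x y ^ α) * φ y

namespace InCone

variable {α K : ℝ} {φ : (ℕ → ℝ) → ℝ}

lemma one (hK : 0 ≤ K) : InCone α K fun _ => 1 :=
  ⟨fun _ => one_pos, fun x y => by
    rw [mul_one]
    exact Real.one_le_exp (mul_nonneg hK (seqDist_rpow_nonneg α x y))⟩

lemma const_mul (h : InCone α K φ) {c : ℝ} (hc : 0 < c) : InCone α K fun x => c * φ x :=
  ⟨fun x => mul_pos hc (h.pos x), fun x y => by
    have := mul_le_mul_of_nonneg_left (h.le x y) hc.le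
    linarith⟩

lemma mono (h : InCone α K φ) {K' : ℝ} (hK : K ≤ K') : InCone α K' φ :=
  ⟨h.pos, fun x y => (h.le x y).trans <| mul_le_mul_of_nonneg_right
    (Real.exp_le_exp.2 (mul_le_mul_of_nonneg_right hK (seqDist_rpow_nonneg α x y))) (h.pos y).le⟩

lemma isHolder_log (h : InCone α K φ) : IsHolder α fun x => Real.log (φ x) := by
  have key : ∀ x y, Real.log (φ x) - Real.log (φ y) ≤ K * seqDist x y ^ α := fun x y => by
    have h1 := Real.log_le_log (h.pos x) (h.le x y)
    rw [Real.log_mul (Real.exp_pos _).ne' (h.pos y).ne', Real.log_exp] at h1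
    linarith
  refine ⟨K, fun x y => abs_le.2 ⟨?_, key x y⟩⟩
  have := key y x
  rw [seqDist_comm] at this
  linarith

lemma isBddCont (hα : 0 < α) (h : InCone α K φ) : IsBddCont φ := by
  have h1 := (h.isHolder_log.isBddCont hα).exp
  have h2 : (fun x => Real.exp (Real.log (φ x))) = φ := funext fun x => Real.exp_log (h.pos x)
  rwa [h2] at h1

/-- A Harnack inequality, valid between any two points because the distance is at most 1. -/
lemma le_exp_mul (hα : 0 < α) (hK : 0 ≤ K) (h : InCone α K φ) (x y : ℕ → ℝ) :
    φ x ≤ Real.exp K * φ y :=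
  (h.le x y).trans <| mul_le_mul_of_nonneg_right
    (Real.exp_le_exp.2 (mul_le_of_le_one_right hK (seqDist_rpow_le_one hα x y))) (h.pos y).le

lemma isHolder (hα : 0 < α) (hK : 0 ≤ K) (h : InCone α K φ) : IsHolder α φ := by
  have key : ∀ x y, φ x - φ y ≤ K * (Real.exp K * φ 0) * seqDist x y ^ α := fun x y => by
    have h2 := h.le_exp_mul hα hK x 0
    have hD := seqDist_rpow_nonneg α x y
    -- The exponential cone condition is linearized by `1 - t ≤ exp (-t)`; the factor `φ x` left
    -- over is controlled by the Harnack bound at `0`.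
    have h3 : (1 - K * seqDist x y ^ α) ≤ Real.exp (-(K * seqDist x y ^ α)) := by
      linarith [Real.add_one_le_exp (-(K * seqDist x y ^ α))]
    have h4 : Real.exp (-(K * seqDist x y ^ α)) * φ x ≤ φ y := by
      rw [Real.exp_neg, inv_mul_le_iff₀ (Real.exp_pos _)]
      exact h.le x y
    have h5 : (1 - K * seqDist x y ^ α) * φ x ≤ φ y :=
      (mul_le_mul_of_nonneg_right h3 (h.pos x).le).trans h4
    have h6 : K * seqDist x y ^ α * φ x ≤ K * seqDist x y ^ α * (Real.exp K * φ 0) :=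
      mul_le_mul_of_nonneg_left h2 (mul_nonneg hK hD)
    linarith
  refine ⟨K * (Real.exp K * φ 0), fun x y => abs_le.2 ⟨?_, key x y⟩⟩
  have := key y x
  rw [seqDist_comm] at this
  linarith

end InCone

/-- Adding a large constant leaves the oscillation unchanged while making it small relative to the
values; `φ + t ≥ C / K` is enough. -/
lemma IsHolder.exists_inCone_add {α K : ℝ} (hα : 0 < α) (hK : 0 < K) {φ : (ℕ → ℝ) → ℝ}
    (h : IsHolder α φ) : ∃ t : ℝ, InCone α K fun x => φ x + t := by
  obtain ⟨M, hM⟩ := h.exists_bound hα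
  obtain ⟨C, hC0, hC⟩ := h.exists_nonneg
  have hM0 : 0 ≤ M := (abs_nonneg _).trans (hM 0)
  refine ⟨M + C / K + 1, fun x => ?_, fun x y => ?_⟩
  · have := abs_le.1 (hM x)
    have : 0 ≤ C / K := by positivity
    linarith
  · have h1 := abs_le.1 (hM y)
    have h2 := (abs_le.1 (hC x y)).2
    have hD := seqDist_rpow_nonneg α x y
    have h3 := Real.add_one_le_exp (K * seqDist x y ^ α)
    have h4 : C / K ≤ φ y + (M + C / K + 1) := by linarith
    have h5 : 0 ≤ φ y + (M + C / K + 1) := le_trans (by positivity) h4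
    have h6 : K * seqDist x y ^ α * (C / K) ≤
        K * seqDist x y ^ α * (φ y + (M + C / K + 1)) :=
      mul_le_mul_of_nonneg_left h4 (by positivity)
    have h7 : K * seqDist x y ^ α * (C / K) = C * seqDist x y ^ α := by field_simp
    have h8 := mul_le_mul_of_nonneg_right h3 h5
    linarith

/-! ### Contraction of the cone by the Ruelle operator -/

section Contraction

variable {f : ℝ → ℝ} [IsProbabilityMeasure (apriori f)] {A : (ℕ → ℝ) → ℝ} {α C : ℝ}

/-- The integrand at `x` is compared with that at `y` for the same prepended `a`: the weight
contributes `C`, the function `K`, and both Hölder terms gain the factor `2 ^ (-α)`. -/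
lemma InCone.ruelleOp (hα : 0 < α) (hA : ∀ x y : ℕ → ℝ, |A x - A y| ≤ C * seqDist x y ^ α)
    {K : ℝ} {φ : (ℕ → ℝ) → ℝ} (h : InCone α K φ) :
    InCone α ((C + K) * 2 ^ (-α)) (ruelleOp f A φ) := by
  have hAb : IsBddCont A := IsHolder.isBddCont hα ⟨C, hA⟩
  have hφ := h.isBddCont hα
  refine ⟨ruelleOp_pos hAb hφ h.pos, fun x y => ?_⟩
  unfold Ruelle.ruelleOp
  rw [← integral_const_mul]
  refine integral_mono (integrable_ruelleOp hAb hφ x)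
    ((integrable_ruelleOp hAb hφ y).const_mul _) fun a => ?_
  have h1 := h.le (prepend a x) (prepend a y)
  have h2 := (abs_le.1 (hA (prepend a x) (prepend a y))).2
  rw [seqDist_rpow_prepend] at h1 h2
  have h3 : Real.exp (A (prepend a x)) ≤
      Real.exp (C * (2 ^ (-α) * seqDist x y ^ α)) * Real.exp (A (prepend a y)) := by
    rw [← Real.exp_add]
    exact Real.exp_le_exp.2 (by linarith)
  have h4 := mul_le_mul h3 h1 (h.pos _).le (by positivity)
  refine h4.trans_eq ?_
  rw [show (C + K) * 2 ^ (-α) * seqDist x y ^ α = C * (2 ^ (-α) * seqDist x y ^ α) +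
    K * (2 ^ (-α) * seqDist x y ^ α) by ring, Real.exp_add]
  ring

/-- The subtraction step: removing a small multiple of `g` from `φ` stays in a wider cone. -/
lemma InCone.sub_const_mul {K s : ℝ} (hα : 0 < α) (hK : 0 < K) {φ g : (ℕ → ℝ) → ℝ}
    (hφ : InCone α K φ) (hg : InCone α K g)
    (hs0 : 0 ≤ s) (hs : ∀ x, s * g x ≤ Real.exp (-(K + 1)) / (2 * K + 1) * φ x) :
    InCone α (K + 1) fun x => φ x - s * g x := by
  have hκ : Real.exp (-(K + 1)) / (2 * K + 1) < 1 := by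
    rw [div_lt_one (by linarith)]
    have : Real.exp (-(K + 1)) < 1 := Real.exp_lt_one_iff.2 (by linarith)
    linarith
  refine ⟨fun x => ?_, fun x y => ?_⟩
  · have := mul_lt_mul_of_pos_right hκ (hφ.pos x)
    linarith [hs x]
  · set D := seqDist x y ^ α with hD
    have hD0 : 0 ≤ D := seqDist_rpow_nonneg α x y
    have hD1 : D ≤ 1 := seqDist_rpow_le_one hα x y
    have hgx : Real.exp (-(K * D)) * g y ≤ g x := by
      rw [Real.exp_neg, inv_mul_le_iff₀ (Real.exp_pos _), hD, seqDist_comm]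
      exact hg.le y x
    -- the gap available on the side of `φ`
    have hgap : D ≤ Real.exp ((K + 1) * D) - Real.exp (K * D) := by
      have h1 : Real.exp ((K + 1) * D) = Real.exp (K * D) * Real.exp D := by
        rw [← Real.exp_add]; ring_nf
      have h2 : 1 ≤ Real.exp (K * D) := Real.one_le_exp (by positivity)
      have h3 := Real.add_one_le_exp D
      rw [h1]
      nlinarith
    -- the amount needed on the side of `g`
    have hneed : Real.exp ((K + 1) * D) - Real.exp (-(K * D)) ≤
        Real.exp (K + 1) * ((2 * K + 1) * D) := by
      have h1 : Real.exp (-(K * D)) = Real.exp ((K + 1) * D) * Real.exp (-((2 * K + 1) * D)) := by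
        rw [← Real.exp_add]; ring_nf
      have h2 : Real.exp ((K + 1) * D) ≤ Real.exp (K + 1) :=
        Real.exp_le_exp.2 (mul_le_of_le_one_right (by linarith) hD1)
      have h3 := Real.add_one_le_exp (-((2 * K + 1) * D))
      calc Real.exp ((K + 1) * D) - Real.exp (-(K * D))
          = Real.exp ((K + 1) * D) * (1 - Real.exp (-((2 * K + 1) * D))) := by rw [h1]; ring
        _ ≤ Real.exp ((K + 1) * D) * ((2 * K + 1) * D) := by gcongr; linarith
        _ ≤ _ := by gcongr
    -- The constant in `hs` is the inverse of the factor `exp (K + 1) * (2 * K + 1)` from `hneed`,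
    -- so the cost of subtracting `s * g` fits exactly in the gap `D * φ y`.
    have h1 : s * (Real.exp ((K + 1) * D) * g y - g x) ≤ D * φ y := by
      calc s * (Real.exp ((K + 1) * D) * g y - g x)
          ≤ s * ((Real.exp ((K + 1) * D) - Real.exp (-(K * D))) * g y) := by
            gcongr; linarith
        _ ≤ s * (Real.exp (K + 1) * ((2 * K + 1) * D) * g y) := by
            have := (hg.pos y).le
            gcongr
        _ = Real.exp (K + 1) * ((2 * K + 1) * D) * (s * g y) := by ring
        _ ≤ Real.exp (K + 1) * ((2 * K + 1) * D) *
            (Real.exp (-(K + 1)) / (2 * K + 1) * φ y) :=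
            mul_le_mul_of_nonneg_left (hs y) (by positivity)
        _ = D * φ y := by
            rw [Real.exp_neg]; field_simp
    have h2 := hφ.le x y
    have h3 := mul_le_mul_of_nonneg_right hgap (hφ.pos y).le
    linarith

/-- The contraction rate in the cone of constant `K`. -/
noncomputable def coneRate (K : ℝ) : ℝ := 1 - Real.exp (-(K + 1)) / (2 * K + 1) * Real.exp (-(4 * K))

lemma coneRate_lt_one {K : ℝ} (hK : 0 < K) : coneRate K < 1 := by
  have : 0 < Real.exp (-(K + 1)) / (2 * K + 1) * Real.exp (-(4 * K)) := by positivity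
  unfold coneRate
  linarith

lemma coneRate_nonneg {K : ℝ} (hK : 0 < K) : 0 ≤ coneRate K := by
  have h1 : Real.exp (-(K + 1)) / (2 * K + 1) ≤ 1 := by
    rw [div_le_one (by linarith)]
    have : Real.exp (-(K + 1)) < 1 := Real.exp_lt_one_iff.2 (by linarith)
    linarith
  have h2 : Real.exp (-(4 * K)) ≤ 1 := Real.exp_le_one_iff.2 (by linarith)
  have := mul_le_one₀ h1 (Real.exp_pos _).le h2
  unfold coneRate
  linarith

/-- `K` is large enough for the cone of constant `K` to absorb the cone of constant `K + 1`. -/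
def Absorbs (α C K : ℝ) : Prop := 0 < K ∧ (C + (K + 1)) * 2 ^ (-α) ≤ K

lemma exists_absorbs (hα : 0 < α) (hC : 0 ≤ C) : ∃ K, Absorbs α C K := by
  have h0 : (0 : ℝ) < 2 ^ (-α) := by positivity
  have h1 : (2 : ℝ) ^ (-α) < 1 := Real.rpow_lt_one_of_one_lt_of_neg (by norm_num) (by linarith)
  have h2 : (0 : ℝ) < 1 - 2 ^ (-α) := by linarith
  -- This is the fixed point of `K ↦ (C + K + 1) * 2 ^ (-α)`.
  refine ⟨(C + 1) * 2 ^ (-α) / (1 - 2 ^ (-α)), by positivity, le_of_eq ?_⟩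
  field_simp
  ring

lemma InCone.ruelleOp_absorbed (hα : 0 < α)
    (hA : ∀ x y : ℕ → ℝ, |A x - A y| ≤ C * seqDist x y ^ α) {K : ℝ} (hK : Absorbs α C K)
    {φ : (ℕ → ℝ) → ℝ} (h : InCone α (K + 1) φ) : InCone α K (Ruelle.ruelleOp f A φ) :=
  (h.ruelleOp hα hA).mono hK.2

lemma InCone.ruelleOp_iterate (hα : 0 < α)
    (hA : ∀ x y : ℕ → ℝ, |A x - A y| ≤ C * seqDist x y ^ α) {K : ℝ} (hK : Absorbs α C K)
    {φ : (ℕ → ℝ) → ℝ} (h : InCone α K φ) (n : ℕ) :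
    InCone α K ((Ruelle.ruelleOp f A)^[n] φ) := by
  induction n with
  | zero => exact h
  | succ n ih =>
    rw [Function.iterate_succ_apply']
    exact (ih.mono (by linarith)).ruelleOp_absorbed hα hA hK

/-- The remainder `φ - s * g` lies in the cone of constant `K + 1`, and the operator brings it back
to constant `K`. Since `s * g` is a definite proportion of `φ` everywhere, the upper bound of the
remainder against `g` drops by the factor `coneRate K`. -/
lemma InCone.exists_contraction_step (hα : 0 < α)
    (hA : ∀ x y : ℕ → ℝ, |A x - A y| ≤ C * seqDist x y ^ α) {K : ℝ} (hK : Absorbs α C K)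
    {φ g : (ℕ → ℝ) → ℝ} (hφ : InCone α K φ) (hg : InCone α K g) {M : ℝ}
    (hM : ∀ x, φ x ≤ M * g x) :
    ∃ (s : ℝ) (φ' : (ℕ → ℝ) → ℝ), InCone α K φ' ∧
      (Ruelle.ruelleOp f A φ = fun x => φ' x + s * Ruelle.ruelleOp f A g x) ∧
      ∀ x, φ' x ≤ coneRate K * M * Ruelle.ruelleOp f A g x := by
  have hK0 := hK.1
  have hAb : IsBddCont A := IsHolder.isBddCont hα ⟨C, hA⟩
  have hφb := hφ.isBddCont hα
  have hgb := hg.isBddCont hα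
  set κ := Real.exp (-(K + 1)) / (2 * K + 1) with hκ
  have hκ0 : 0 < κ := by positivity
  -- By the Harnack bounds, `exp (-(2 * K)) * (φ 0 / g 0)` is below `φ / g` at every point (`hcmp`)
  -- and loses at most a factor `exp (4 * K)` there (`hcmp'`). The factor `κ` is what
  -- `InCone.sub_const_mul` tolerates.
  set s := κ * Real.exp (-(2 * K)) * (φ 0 / g 0) with hs
  have hφ0 := hφ.pos 0
  have hg0 := hg.pos 0
  have hs0 : 0 ≤ s := by positivity
  have e2 : Real.exp (2 * K) = Real.exp K * Real.exp K := by rw [← Real.exp_add]; ring_nf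
  have hcmp : ∀ x, Real.exp (-(2 * K)) * (φ 0 / g 0) * g x ≤ φ x := fun x => by
    rw [Real.exp_neg, mul_assoc, inv_mul_le_iff₀ (Real.exp_pos _), div_mul_eq_mul_div,
      div_le_iff₀ hg0]
    calc φ 0 * g x ≤ (Real.exp K * φ x) * (Real.exp K * g 0) :=
          mul_le_mul (hφ.le_exp_mul hα hK0.le 0 x) (hg.le_exp_mul hα hK0.le x 0) (hg.pos x).le
            (mul_nonneg (Real.exp_pos _).le (hφ.pos x).le)
      _ = Real.exp (2 * K) * φ x * g 0 := by rw [e2]; ring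
  have hcmp' : ∀ x, Real.exp (-(4 * K)) * φ x ≤ Real.exp (-(2 * K)) * (φ 0 / g 0) * g x :=
    fun x => by
    rw [show -(4 * K) = -(2 * K) + -(2 * K) by ring, Real.exp_add, mul_assoc, mul_assoc]
    refine mul_le_mul_of_nonneg_left ?_ (Real.exp_pos _).le
    rw [Real.exp_neg, inv_mul_le_iff₀ (Real.exp_pos _), div_mul_eq_mul_div, mul_div_assoc',
      le_div_iff₀ hg0]
    calc φ x * g 0 ≤ (Real.exp K * φ 0) * (Real.exp K * g x) :=
          mul_le_mul (hφ.le_exp_mul hα hK0.le x 0) (hg.le_exp_mul hα hK0.le 0 x) hg0.le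
            (mul_nonneg (Real.exp_pos _).le hφ0.le)
      _ = Real.exp (2 * K) * (φ 0 * g x) := by rw [e2]; ring
  have hsκ : ∀ x, s * g x ≤ κ * φ x := fun x => by
    have := mul_le_mul_of_nonneg_left (hcmp x) hκ0.le
    rw [hs]
    linarith
  have hr : InCone α (K + 1) fun x => φ x - s * g x :=
    InCone.sub_const_mul hα hK0 hφ hg hs0 hsκ
  have hsub : ∀ x, Ruelle.ruelleOp f A (fun y => φ y - s * g y) x =
      Ruelle.ruelleOp f A φ x - s * Ruelle.ruelleOp f A g x := fun x => by
    rw [ruelleOp_sub hAb hφb (hgb.const_mul s), ruelleOp_const_mul]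
  refine ⟨s, _, hr.ruelleOp_absorbed (f := f) hα hA hK, funext fun x => ?_, fun x => ?_⟩
  · rw [hsub]; ring
  · rw [← ruelleOp_const_mul]
    refine ruelleOp_mono hAb (hr.isBddCont hα) (hgb.const_mul _) (fun y => ?_) x
    have h1 := mul_le_mul_of_nonneg_left (hcmp' y) hκ0.le
    have h2 : φ y - s * g y ≤ coneRate K * φ y := by
      rw [coneRate, ← hκ, hs]
      linarith
    have h3 := mul_le_mul_of_nonneg_left (hM y) (coneRate_nonneg hK0)
    linarith

/-- Each step peels off a multiple of the current image of `g`; `c` collects these multiples, and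
the remainder, positive and at most `coneRate K ^ n * M` times the image of `g`, is the error. -/
lemma InCone.exists_iterate_bounds (hα : 0 < α)
    (hA : ∀ x y : ℕ → ℝ, |A x - A y| ≤ C * seqDist x y ^ α) {K : ℝ} (hK : Absorbs α C K)
    (n : ℕ) {φ g : (ℕ → ℝ) → ℝ} (hφ : InCone α K φ) (hg : InCone α K g) {M : ℝ}
    (hM : ∀ x, φ x ≤ M * g x) :
    ∃ c : ℝ, ∀ x, c * (Ruelle.ruelleOp f A)^[n] g x ≤ (Ruelle.ruelleOp f A)^[n] φ x ∧
      (Ruelle.ruelleOp f A)^[n] φ x ≤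
        (c + coneRate K ^ n * M) * (Ruelle.ruelleOp f A)^[n] g x := by
  have hAb : IsBddCont A := IsHolder.isBddCont hα ⟨C, hA⟩
  induction n generalizing φ g M with
  | zero => exact ⟨0, fun x => ⟨by simpa using (hφ.pos x).le, by simpa using hM x⟩⟩
  | succ n ih =>
    obtain ⟨s, φ', hφ', heq, hle⟩ := hφ.exists_contraction_step (f := f) hα hA hK hg hM
    have hg' : InCone α K (Ruelle.ruelleOp f A g) :=
      (hg.mono (by linarith)).ruelleOp_absorbed hα hA hK
    obtain ⟨c, hc⟩ := ih hφ' hg' hle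
    refine ⟨c + s, fun x => ?_⟩
    have hsplit : (Ruelle.ruelleOp f A)^[n] (fun x => φ' x + s * Ruelle.ruelleOp f A g x) x =
        (Ruelle.ruelleOp f A)^[n] φ' x + s * (Ruelle.ruelleOp f A)^[n] (Ruelle.ruelleOp f A g) x := by
      rw [ruelleOp_iterate_add hAb (hφ'.isBddCont hα) ((hg'.isBddCont hα).const_mul s),
        ruelleOp_iterate_const_mul]
    rw [Function.iterate_succ_apply, Function.iterate_succ_apply, heq, hsplit]
    obtain ⟨h1, h2⟩ := hc x
    rw [pow_succ]
    constructor <;> linarith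

end Contraction

/-! ### The positive eigenfunction and the maximal eigenvalue -/

section Eigen

variable {f : ℝ → ℝ} [IsProbabilityMeasure (apriori f)] {A : (ℕ → ℝ) → ℝ} {α C : ℝ}

/-- The iterates of `1`, normalized at the zero sequence, are uniformly Cauchy. -/
lemma abs_iterate_one_div_sub_le (hα : 0 < α)
    (hA : ∀ x y : ℕ → ℝ, |A x - A y| ≤ C * seqDist x y ^ α) {K : ℝ} (hK : Absorbs α C K)
    (n k : ℕ) (x : ℕ → ℝ) :
    |(ruelleOp f A)^[n + k] (fun _ => 1) x / (ruelleOp f A)^[n + k] (fun _ => 1) 0 -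
        (ruelleOp f A)^[n] (fun _ => 1) x / (ruelleOp f A)^[n] (fun _ => 1) 0| ≤
      Real.exp (3 * K) * coneRate K ^ n := by
  have hK0 := hK.1
  have hAb : IsBddCont A := IsHolder.isBddCont hα ⟨C, hA⟩
  have h1 : InCone α K fun _ => 1 := InCone.one hK0.le
  have hg : ∀ m, InCone α K ((ruelleOp f A)^[m] fun _ => 1) := fun m =>
    h1.ruelleOp_iterate hα hA hK m
  have hk0 := (hg k).pos 0
  have hn0 := (hg n).pos 0
  have hnx := (hg n).pos x
  have hnk0 := (hg (n + k)).pos 0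
  set L := ruelleOp f A with hL
  -- The later iterate is written as the `n`-th image of the normalized `k`-th iterate and compared
  -- with the `n`-th image of `1`. The initial bound `exp K` does not depend on `k`.
  have hφ : InCone α K fun y => (L^[k] (fun _ => 1) 0)⁻¹ * L^[k] (fun _ => 1) y :=
    (hg k).const_mul (inv_pos.2 hk0)
  have hM : ∀ y, (L^[k] (fun _ => 1) 0)⁻¹ * L^[k] (fun _ => 1) y ≤ Real.exp K * 1 := fun y => by
    rw [inv_mul_le_iff₀ hk0]
    linarith [(hg k).le_exp_mul hα hK0.le y 0]
  obtain ⟨c, hc⟩ := hφ.exists_iterate_bounds (f := f) hα hA hK n h1 hM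
  have hit : ∀ y, L^[n] (fun y => (L^[k] (fun _ => 1) 0)⁻¹ * L^[k] (fun _ => 1) y) y =
      (L^[k] (fun _ => 1) 0)⁻¹ * L^[n + k] (fun _ => 1) y := fun y => by
    rw [hL, ruelleOp_iterate_const_mul, Function.iterate_add_apply]
  simp only [← hL, hit] at hc
  -- a lower bound for the normalizing factor
  have hlow : Real.exp (-K) * L^[n] (fun _ => 1) 0 ≤
      (L^[k] (fun _ => 1) 0)⁻¹ * L^[n + k] (fun _ => 1) 0 := by
    rw [← hit, hL, ← ruelleOp_iterate_const_mul]
    refine ruelleOp_iterate_mono hAb ((isBddCont_const 1).const_mul _) (hφ.isBddCont hα)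
      (fun y => ?_) n 0
    rw [le_inv_mul_iff₀ hk0, Real.exp_neg, mul_one, mul_inv_le_iff₀ (Real.exp_pos _)]
    linarith [(hg k).le_exp_mul hα hK0.le 0 y]
  have hx := hc x
  have h0 := hc 0
  have hgx := (hg n).le_exp_mul hα hK0.le x 0
  set u := (L^[k] (fun _ => 1) 0)⁻¹ with hu
  have hu0 : 0 < u := inv_pos.2 hk0
  generalize L^[n + k] (fun _ => 1) x = px at *
  generalize L^[n + k] (fun _ => 1) 0 = p0 at *
  generalize L^[n] (fun _ => 1) x = qx at *
  generalize L^[n] (fun _ => 1) 0 = q0 at *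
  set δ := coneRate K ^ n * Real.exp K with hδ
  have hδ0 : 0 ≤ δ := mul_nonneg (pow_nonneg (coneRate_nonneg hK0) n) (Real.exp_pos _).le
  have hdiff : |u * px * q0 - u * p0 * qx| ≤ δ * (q0 * qx) := by
    have a1 := mul_le_mul_of_nonneg_right hx.1 hn0.le
    have a2 := mul_le_mul_of_nonneg_right hx.2 hn0.le
    have a3 := mul_le_mul_of_nonneg_right h0.1 hnx.le
    have a4 := mul_le_mul_of_nonneg_right h0.2 hnx.le
    rw [abs_le]
    -- The unknown `c` cancels: both ratios, at `x` and at `0`, lie in the same interval of length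
    -- `δ`.
    constructor <;> linarith
  have hfrac : px / p0 - qx / q0 = (u * px * q0 - u * p0 * qx) / (u * p0 * q0) := by
    field_simp
  rw [hfrac, abs_div, abs_of_pos (by positivity : 0 < u * p0 * q0), div_le_iff₀ (by positivity)]
  refine hdiff.trans ?_
  have e3 : Real.exp (3 * K) = Real.exp K * Real.exp K * Real.exp K := by
    rw [← Real.exp_add, ← Real.exp_add]; ring_nf
  have hlow' : q0 ≤ Real.exp K * (u * p0) := by
    rw [Real.exp_neg, inv_mul_le_iff₀ (Real.exp_pos _)] at hlow
    exact hlow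
  calc δ * (q0 * qx) ≤ δ * (q0 * (Real.exp K * (Real.exp K * (u * p0)))) := by
        gcongr
        exact hgx.trans (mul_le_mul_of_nonneg_left hlow' (Real.exp_pos _).le)
    _ = Real.exp (3 * K) * coneRate K ^ n * (u * p0 * q0) := by rw [e3, hδ]; ring

/-- The normalized iterates of `1` converge, and the cone inequalities survive pointwise limits. The
limit is strictly positive because its value at `0` is 1. -/
lemma exists_inCone_eigenfunction (hα : 0 < α)
    (hA : ∀ x y : ℕ → ℝ, |A x - A y| ≤ C * seqDist x y ^ α) {K : ℝ} (hK : Absorbs α C K) :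
    ∃ (lam : ℝ) (ψ : (ℕ → ℝ) → ℝ), 0 < lam ∧ InCone α K ψ ∧
      ∀ x, ruelleOp f A ψ x = lam * ψ x := by
  have hK0 := hK.1
  have hAb : IsBddCont A := IsHolder.isBddCont hα ⟨C, hA⟩
  have hg : ∀ m, InCone α K ((ruelleOp f A)^[m] fun _ => 1) := fun m =>
    (InCone.one hK0.le).ruelleOp_iterate hα hA hK m
  set h : ℕ → (ℕ → ℝ) → ℝ := fun n x =>
    (ruelleOp f A)^[n] (fun _ => 1) x / (ruelleOp f A)^[n] (fun _ => 1) 0 with hh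
  have hcone : ∀ n, InCone α K (h n) := fun n => by
    have := (hg n).const_mul (inv_pos.2 ((hg n).pos 0))
    simpa only [hh, div_eq_inv_mul] using this
  have hone : ∀ n, h n 0 = 1 := fun n => div_self ((hg n).pos 0).ne'
  have hlim : ∀ x, ∃ l, Tendsto (fun n => h n x) atTop (𝓝 l) := fun x => by
    refine cauchySeq_tendsto_of_complete (cauchySeq_of_le_tendsto_0'
      (fun n => Real.exp (3 * K) * coneRate K ^ n) (fun n m hnm => ?_) ?_)
    · obtain ⟨k, rfl⟩ := Nat.exists_eq_add_of_le hnm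
      rw [dist_comm]
      exact abs_iterate_one_div_sub_le hα hA hK n k x
    · simpa using (tendsto_pow_atTop_nhds_zero_of_lt_one (coneRate_nonneg hK0)
        (coneRate_lt_one hK0)).const_mul (Real.exp (3 * K))
  choose ψ hψ using hlim
  have hψ0 : ψ 0 = 1 := tendsto_nhds_unique (hψ 0) (by simp [hone])
  have hle : ∀ x y, ψ x ≤ Real.exp (K * seqDist x y ^ α) * ψ y := fun x y =>
    le_of_tendsto_of_tendsto' (hψ x) ((hψ y).const_mul _) fun n => (hcone n).le x y
  have hψc : InCone α K ψ := by
    refine ⟨fun x => ?_, hle⟩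
    have := hle 0 x
    rw [hψ0] at this
    exact pos_of_mul_pos_right (one_pos.trans_le this) (Real.exp_pos _).le
  have hL : ∀ x, Tendsto (fun n => ruelleOp f A (h n) x) atTop (𝓝 (ruelleOp f A ψ x)) := by
    intro x
    refine tendsto_integral_of_dominated_convergence
      (fun a => Real.exp (A (prepend a x)) * Real.exp K)
      (fun n => (integrable_ruelleOp hAb ((hcone n).isBddCont hα) x).aestronglyMeasurable)
      (integrable_ruelleOp hAb (isBddCont_const (Real.exp K)) x)
      (fun n => ae_of_all _ fun a => ?_) (ae_of_all _ fun a => (hψ _).const_mul _)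
    have h1 := (hcone n).le_exp_mul hα hK0.le (prepend a x) 0
    rw [hone, mul_one] at h1
    rw [Real.norm_of_nonneg (mul_nonneg (Real.exp_pos _).le ((hcone n).pos _).le)]
    gcongr
  -- One application carries a normalized iterate to the next up to its value at `0`, so in the
  -- limit that value is the eigenvalue.
  have hstep : ∀ n x, ruelleOp f A (h n) x = ruelleOp f A (h n) 0 * h (n + 1) x := by
    intro n x
    have e : h n = fun y => ((ruelleOp f A)^[n] (fun _ => 1) 0)⁻¹ *
        (ruelleOp f A)^[n] (fun _ => 1) y := by
      funext y
      simp only [hh, div_eq_inv_mul]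
    have e2 : ∀ y, ruelleOp f A (h n) y = ((ruelleOp f A)^[n] (fun _ => 1) 0)⁻¹ *
        (ruelleOp f A)^[n + 1] (fun _ => 1) y := fun y => by
      rw [e, ruelleOp_const_mul, Function.iterate_succ_apply']
    have := ((hg (n + 1)).pos 0).ne'
    rw [e2, e2]
    simp only [hh]
    field_simp
  refine ⟨ruelleOp f A ψ 0, ψ, ruelleOp_pos hAb (hψc.isBddCont hα) hψc.pos 0, hψc, fun x => ?_⟩
  refine tendsto_nhds_unique (hL x) ?_
  simp_rw [hstep _ x]
  exact (hL 0).mul ((hψ x).comp (tendsto_add_atTop_nat 1))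

/-- The eigenfunction `ψ` is bounded below, so a bounded `φ` satisfies `|φ| ≤ B * ψ`. Iterating
gives `|c| ^ n * |φ| ≤ lam ^ n * B * ψ`, which forces `φ = 0` when `|c| > lam`. -/
lemma isMaximalEigenvalue_of_inCone (hα : 0 < α) (hA : IsHolder α A) {K lam : ℝ} (hK : 0 ≤ K)
    {ψ : (ℕ → ℝ) → ℝ} (hlam : 0 < lam) (hψ : InCone α K ψ)
    (heig : ∀ x, ruelleOp f A ψ x = lam * ψ x) : IsMaximalEigenvalue f α A lam := by
  have hAb := hA.isBddCont hα
  have hψb := hψ.isBddCont hα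
  refine ⟨⟨ψ, hlam, hψ.isHolder hα hK, hψ.pos, heig⟩, fun c φ hφ hc => ?_⟩
  by_contra hlt
  push Not at hlt
  refine hφ (DFunLike.ext _ _ fun x => ?_)
  have hφb := isBddCont_coe φ
  set B := ‖φ‖ * (Real.exp K / ψ 0) with hB
  have hbound : ∀ y, |φ y| ≤ B * ψ y := fun y => by
    have h1 := hψ.le_exp_mul hα hK 0 y
    have h2 : 1 ≤ Real.exp K / ψ 0 * ψ y := by
      rwa [div_mul_eq_mul_div, le_div_iff₀ (hψ.pos 0), one_mul]
    calc |φ y| ≤ ‖φ‖ * 1 := by simpa using φ.norm_coe_le_norm y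
      _ ≤ ‖φ‖ * (Real.exp K / ψ 0 * ψ y) := by gcongr
      _ = B * ψ y := by rw [hB]; ring
  have hiter : ∀ n : ℕ, ∀ y, |c| ^ n * |φ y| ≤ lam ^ n * (B * ψ y) := by
    intro n
    induction n with
    | zero => simpa using hbound
    | succ n ih =>
      intro y
      have h1 : |c| * |φ y| ≤ ruelleOp f A (fun z => |φ z|) y := by
        rw [← abs_mul, ← hc]
        exact abs_ruelleOp_le _ _
      calc |c| ^ (n + 1) * |φ y| = |c| ^ n * (|c| * |φ y|) := by ring
        _ ≤ |c| ^ n * ruelleOp f A (fun z => |φ z|) y := by gcongr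
        _ = ruelleOp f A (fun z => |c| ^ n * |φ z|) y := (ruelleOp_const_mul _ _ _).symm
        _ ≤ ruelleOp f A (fun z => lam ^ n * B * ψ z) y :=
            ruelleOp_mono hAb (hφb.abs.const_mul _) (hψb.const_mul _)
              (fun z => (ih z).trans_eq (by ring)) y
        _ = lam ^ (n + 1) * (B * ψ y) := by rw [ruelleOp_const_mul, heig]; ring
  have hc0 : 0 < |c| := hlam.trans hlt
  have hle : ∀ n : ℕ, |φ x| ≤ (lam / |c|) ^ n * (B * ψ x) := fun n => by
    rw [div_pow, div_mul_eq_mul_div, le_div_iff₀ (by positivity), mul_comm]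
    exact hiter n x
  have hlim := (tendsto_pow_atTop_nhds_zero_of_lt_one (by positivity : 0 ≤ lam / |c|)
    ((div_lt_one hc0).2 hlt)).mul_const (B * ψ x)
  rw [zero_mul] at hlim
  simpa using abs_nonpos_iff.1 (ge_of_tendsto' hlim hle)

end Eigen

/-- Each of the two numbers has a nonzero bounded continuous eigenfunction, so it is subject to the
maximality of the other. -/
lemma IsMaximalEigenvalue.unique {f : ℝ → ℝ} {A : (ℕ → ℝ) → ℝ} {α : ℝ} (hα : 0 < α)
    {lam lam' : ℝ}
    (h : IsMaximalEigenvalue f α A lam) (h' : IsMaximalEigenvalue f α A lam') : lam = lam' := by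
  have key : ∀ {l l' : ℝ}, IsMaximalEigenvalue f α A l → IsMaximalEigenvalue f α A l' →
      l ≤ l' := by
    intro l l' hl hl'
    obtain ⟨ψ, hψ⟩ := hl.exists_eigenfunction
    obtain ⟨Ψ, hΨ⟩ := (hψ.holder.isBddCont hα).exists_coe
    refine (le_abs_self l).trans (hl'.maximal l Ψ ?_ ?_)
    · intro h0
      have := hψ.pos 0
      rw [← hΨ, h0] at this
      exact lt_irrefl _ this
    · rw [hΨ]
      exact hψ.eigen
  exact le_antisymm (key h h') (key h' h)

/-! ### The normalized potential -/

lemma InCone.inv {α K : ℝ} {φ : (ℕ → ℝ) → ℝ} (h : InCone α K φ) :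
    InCone α K fun x => (φ x)⁻¹ :=
  ⟨fun x => inv_pos.2 (h.pos x), fun x y => by
    have h1 := h.le y x
    rw [seqDist_comm] at h1
    rw [← div_eq_mul_inv, le_div_iff₀ (h.pos y), inv_mul_le_iff₀ (h.pos x), mul_comm]
    exact h1⟩

lemma InCone.isHolder_normalized {α K : ℝ} (hα : 0 < α) {A : (ℕ → ℝ) → ℝ} (hA : IsHolder α A)
    {ψ : (ℕ → ℝ) → ℝ} (hψ : InCone α K ψ) (lam : ℝ) : IsHolder α (normalized A lam ψ) :=
  ((hA.add hψ.isHolder_log).sub hα (hψ.isHolder_log.comp_shift hα)).sub hα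
    (isHolder_const α (Real.log lam))

lemma exp_normalized_prepend {A ψ : (ℕ → ℝ) → ℝ} {lam : ℝ} (hlam : 0 < lam)
    (hψ : ∀ x, 0 < ψ x) (a : ℝ) (x : ℕ → ℝ) :
    Real.exp (normalized A lam ψ (prepend a x)) =
      (lam * ψ x)⁻¹ * (Real.exp (A (prepend a x)) * ψ (prepend a x)) := by
  rw [normalized, shift_prepend, Real.exp_sub, Real.exp_sub, Real.exp_add,
    Real.exp_log (hψ _), Real.exp_log (hψ _), Real.exp_log hlam]
  field_simp

lemma ruelleOp_normalized {f : ℝ → ℝ} {A ψ : (ℕ → ℝ) → ℝ} {lam : ℝ} (hlam : 0 < lam)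
    (hψ : ∀ x, 0 < ψ x) (φ : (ℕ → ℝ) → ℝ) (x : ℕ → ℝ) :
    ruelleOp f (normalized A lam ψ) φ x =
      (lam * ψ x)⁻¹ * ruelleOp f A (fun y => ψ y * φ y) x := by
  unfold ruelleOp
  rw [← integral_const_mul]
  congr 1 with a
  rw [exp_normalized_prepend hlam hψ]
  ring

lemma IsPositiveEigenpair.ruelleOp_normalized_one {f : ℝ → ℝ} {α : ℝ} {A ψ : (ℕ → ℝ) → ℝ}
    {lam : ℝ} (h : IsPositiveEigenpair f α A lam ψ) (x : ℕ → ℝ) :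
    ruelleOp f (normalized A lam ψ) (fun _ => 1) x = 1 := by
  rw [ruelleOp_normalized h.eigenvalue_pos h.pos]
  simp only [mul_one]
  rw [h.eigen]
  exact inv_mul_cancel₀ (mul_pos h.eigenvalue_pos (h.pos x)).ne'

/-! ### Loss of oscillation and independence of the eigenfunction -/

section Normalized

variable {f : ℝ → ℝ} [IsProbabilityMeasure (apriori f)] {B : (ℕ → ℝ) → ℝ} {α : ℝ}

/-- Under a normalized Hölder potential, the oscillation of the iterates of a Hölder function
tends to zero. -/
lemma exists_tendsto_zero_abs_iterate_sub_le (hα : 0 < α) (hB : IsHolder α B)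
    (hB1 : ∀ x, ruelleOp f B (fun _ => 1) x = 1) {φ : (ℕ → ℝ) → ℝ} (hφ : IsHolder α φ) :
    ∃ r : ℕ → ℝ, Tendsto r atTop (𝓝 0) ∧
      ∀ n x y, |(ruelleOp f B)^[n] φ x - (ruelleOp f B)^[n] φ y| ≤ r n := by
  obtain ⟨C, hC0, hC⟩ := hB.exists_nonneg
  have hBb := hB.isBddCont hα
  obtain ⟨K, hK⟩ := exists_absorbs hα hC0
  -- The shift by `t` puts `φ` in the cone; as constants are fixed, it does not affect the
  -- oscillation.
  obtain ⟨t, ht⟩ := hφ.exists_inCone_add hα hK.1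
  have hM : ∀ x, φ x + t ≤ Real.exp K * (φ 0 + t) * 1 := fun x => by
    rw [mul_one]
    exact ht.le_exp_mul hα hK.1.le x 0
  have hone : ∀ n : ℕ, (ruelleOp f B)^[n] (fun _ => 1) = fun _ => 1 := fun n =>
    Function.iterate_fixed (funext hB1) n
  refine ⟨fun n => coneRate K ^ n * (Real.exp K * (φ 0 + t)), ?_, fun n x y => ?_⟩
  · simpa using (tendsto_pow_atTop_nhds_zero_of_lt_one (coneRate_nonneg hK.1)
      (coneRate_lt_one hK.1)).mul_const (Real.exp K * (φ 0 + t))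
  · obtain ⟨c, hc⟩ := ht.exists_iterate_bounds (f := f) hα hC hK n (InCone.one hK.1.le) hM
    have hadd : ∀ z, (ruelleOp f B)^[n] (fun w => φ w + t) z = (ruelleOp f B)^[n] φ z + t :=
      fun z => by
        have h1 := ruelleOp_iterate_add (f := f) hBb (hφ.isBddCont hα)
          ((isBddCont_const 1).const_mul t) n z
        rw [ruelleOp_iterate_const_mul, hone] at h1
        simpa using h1
    have hx := hc x
    have hy := hc y
    rw [hone, hadd] at hx hy
    rw [abs_le]
    constructor <;> linarith

/-- The quotient `ψ / ψ₀` is a Hölder fixed point of the normalized operator, so its oscillation is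
at most one that tends to zero. It is therefore constant, and constants drop out of the coboundary.
-/
lemma normalized_eq_of_eigenpair (hα : 0 < α) {A : (ℕ → ℝ) → ℝ} (hA : IsHolder α A)
    {K lam : ℝ} (hK : 0 ≤ K) {ψ₀ ψ : (ℕ → ℝ) → ℝ} (hc : InCone α K ψ₀)
    (h₀ : IsPositiveEigenpair f α A lam ψ₀) (h : IsPositiveEigenpair f α A lam ψ) :
    normalized A lam ψ = normalized A lam ψ₀ := by
  have hlam := h.eigenvalue_pos
  have hfix : ruelleOp f (normalized A lam ψ₀) (fun x => ψ x * (ψ₀ x)⁻¹) =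
      fun x => ψ x * (ψ₀ x)⁻¹ := by
    funext x
    have e : (fun y => ψ₀ y * (ψ y * (ψ₀ y)⁻¹)) = ψ := by
      funext y
      have := (h₀.pos y).ne'
      field_simp
    have := (h₀.pos x).ne'
    rw [ruelleOp_normalized hlam h₀.pos, e, h.eigen]
    field_simp
  obtain ⟨r, hr, hle⟩ := exists_tendsto_zero_abs_iterate_sub_le hα
    (hc.isHolder_normalized hα hA lam) h₀.ruelleOp_normalized_one
    (h.holder.mul hα (hc.inv.isHolder hα hK))
  have hconst : ∀ x, ψ x * (ψ₀ x)⁻¹ = ψ 0 * (ψ₀ 0)⁻¹ := fun x => by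
    have h1 : ∀ n, |ψ x * (ψ₀ x)⁻¹ - ψ 0 * (ψ₀ 0)⁻¹| ≤ r n := fun n => by
      have h2 := hle n x 0
      rwa [Function.iterate_fixed hfix n] at h2
    exact sub_eq_zero.1 (abs_nonpos_iff.1 (ge_of_tendsto' hr h1))
  have hlog : ∀ x, Real.log (ψ x) = Real.log (ψ₀ x) + Real.log (ψ 0 * (ψ₀ 0)⁻¹) := fun x => by
    rw [← hconst x, Real.log_mul (h.pos x).ne' (inv_pos.2 (h₀.pos x)).ne', Real.log_inv]
    ring
  funext x
  simp only [normalized, hlog]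
  ring

end Normalized

/-! ### Hölder functions determine measures -/

/-- The bounded Hölder functions form an algebra that separates points through the arctangents of
the coordinates, and such an algebra determines finite measures on a Polish space. -/
lemma ext_of_forall_isHolder {α : ℝ} (hα : 0 < α) (hα1 : α ≤ 1) {μ ν : Measure (ℕ → ℝ)}
    [IsFiniteMeasure μ] [IsFiniteMeasure ν]
    (h : ∀ φ, IsHolder α φ → ∫ x, φ x ∂μ = ∫ x, φ x ∂ν) : μ = ν := by
  let S : StarSubalgebra ℝ ((ℕ → ℝ) →ᵇ ℝ) :=
    { carrier := {φ | IsHolder α φ}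
      mul_mem' := fun ha hb => IsHolder.mul hα ha hb
      add_mem' := fun ha hb => IsHolder.add ha hb
      algebraMap_mem' := fun r => isHolder_const α r
      star_mem' := fun ha => by simpa using ha }
  refine ext_of_forall_mem_subalgebra_integral_eq_of_polish (𝕜 := ℝ) (A := S) ?_
    fun g hg => h g hg
  intro x y hxy
  obtain ⟨n, hn⟩ := Function.ne_iff.1 hxy
  have hH := isHolder_arctan_apply hα hα1 n
  obtain ⟨Φ, hΦ⟩ := (hH.isBddCont hα).exists_coe
  refine ⟨Φ, ⟨Φ.toContinuousMap, ⟨Φ, ?_, rfl⟩, rfl⟩, ?_⟩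
  · change IsHolder α Φ
    rwa [hΦ]
  · rw [hΦ]
    exact fun he => hn (Real.arctan_injective he)

/-! ### The dual operator on measures -/

lemma measurable_prepend : Measurable fun p : ℝ × (ℕ → ℝ) => prepend p.1 p.2 :=
  continuous_prepend.measurable

/-- The dual Ruelle operator on measures. -/
noncomputable def dualOp (f : ℝ → ℝ) (B : (ℕ → ℝ) → ℝ) (μ : Measure (ℕ → ℝ)) :
    Measure (ℕ → ℝ) :=
  (((apriori f).prod μ).withDensity fun p =>
    ENNReal.ofReal (Real.exp (B (prepend p.1 p.2)))).map fun p => prepend p.1 p.2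

section Dual

variable {f : ℝ → ℝ} [IsProbabilityMeasure (apriori f)] {B : (ℕ → ℝ) → ℝ} {α : ℝ}

lemma lintegral_exp_normalized (hB : IsBddCont B) (hB1 : ∀ x, ruelleOp f B (fun _ => 1) x = 1)
    (x : ℕ → ℝ) :
    ∫⁻ a, ENNReal.ofReal (Real.exp (B (prepend a x))) ∂(apriori f) = 1 := by
  rw [← ofReal_integral_eq_lintegral_ofReal (hB.exp.integrable_prepend x)
    (ae_of_all _ fun a => (Real.exp_pos _).le)]
  have := hB1 x
  simp only [ruelleOp, mul_one] at this
  rw [this, ENNReal.ofReal_one]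

lemma lintegral_dualOp (hB : Continuous B) (μ : Measure (ℕ → ℝ)) [SFinite μ]
    {g : (ℕ → ℝ) → ENNReal} (hg : Measurable g) :
    ∫⁻ x, g x ∂(dualOp f B μ) =
      ∫⁻ x, ∫⁻ a, ENNReal.ofReal (Real.exp (B (prepend a x))) * g (prepend a x)
        ∂(apriori f) ∂μ := by
  have hd : Measurable fun p : ℝ × (ℕ → ℝ) => ENNReal.ofReal (Real.exp (B (prepend p.1 p.2))) :=
    (Real.continuous_exp.comp (hB.comp continuous_prepend)).measurable.ennreal_ofReal
  have hgp : Measurable fun p : ℝ × (ℕ → ℝ) => g (prepend p.1 p.2) := hg.comp measurable_prepend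
  rw [dualOp, lintegral_map hg measurable_prepend, lintegral_withDensity_eq_lintegral_mul _ hd hgp,
    lintegral_prod_symm _ (hd.mul hgp).aemeasurable]
  rfl

lemma isProbabilityMeasure_dualOp (hB : IsBddCont B)
    (hB1 : ∀ x, ruelleOp f B (fun _ => 1) x = 1) (μ : Measure (ℕ → ℝ))
    [IsProbabilityMeasure μ] : IsProbabilityMeasure (dualOp f B μ) := by
  constructor
  have h := lintegral_dualOp (f := f) hB.1 μ (g := fun _ => 1) measurable_const
  simpa [lintegral_exp_normalized hB hB1] using h

lemma integral_dualOp (hB : IsBddCont B) (μ : Measure (ℕ → ℝ)) [IsFiniteMeasure μ]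
    {φ : (ℕ → ℝ) → ℝ} (hφ : IsBddCont φ) :
    ∫ x, φ x ∂(dualOp f B μ) = ∫ x, ruelleOp f B φ x ∂μ := by
  have hd : Measurable fun p : ℝ × (ℕ → ℝ) => ENNReal.ofReal (Real.exp (B (prepend p.1 p.2))) :=
    (Real.continuous_exp.comp (hB.1.comp continuous_prepend)).measurable.ennreal_ofReal
  have hprod := hB.exp.mul hφ
  obtain ⟨C, hC⟩ := hprod.2
  rw [dualOp, integral_map measurable_prepend.aemeasurable hφ.1.aestronglyMeasurable,
    integral_withDensity_eq_integral_toReal_smul hd (ae_of_all _ fun _ => ENNReal.ofReal_lt_top)]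
  simp only [ENNReal.toReal_ofReal (Real.exp_pos _).le, smul_eq_mul]
  rw [integral_prod_symm]
  · rfl
  · exact Integrable.of_bound (hprod.1.comp continuous_prepend).aestronglyMeasurable C
      (ae_of_all _ fun p => hC _)

lemma isProbabilityMeasure_dualOp_iterate (hB : IsBddCont B)
    (hB1 : ∀ x, ruelleOp f B (fun _ => 1) x = 1) (μ : Measure (ℕ → ℝ))
    [IsProbabilityMeasure μ] (n : ℕ) : IsProbabilityMeasure ((dualOp f B)^[n] μ) := by
  induction n with
  | zero => assumption
  | succ n ih =>
    rw [Function.iterate_succ_apply']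
    exact isProbabilityMeasure_dualOp hB hB1 _

lemma integral_dualOp_iterate (hB : IsBddCont B)
    (hB1 : ∀ x, ruelleOp f B (fun _ => 1) x = 1) (μ : Measure (ℕ → ℝ))
    [IsProbabilityMeasure μ] {φ : (ℕ → ℝ) → ℝ} (hφ : IsBddCont φ) (n : ℕ) :
    ∫ x, φ x ∂((dualOp f B)^[n] μ) = ∫ x, (ruelleOp f B)^[n] φ x ∂μ := by
  induction n generalizing φ with
  | zero => rfl
  | succ n ih =>
    have := isProbabilityMeasure_dualOp_iterate hB hB1 μ n
    rw [Function.iterate_succ_apply', Function.iterate_succ_apply, integral_dualOp hB _ hφ,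
      ih (hB.ruelleOp hφ)]

/-- The one-coordinate marginals of the iterates of the dual operator are uniformly dominated. -/
lemma dualOp_iterate_apply_preimage_le (hB : IsBddCont B)
    (hB1 : ∀ x, ruelleOp f B (fun _ => 1) x = 1) {C : ℝ} (hC : ∀ x, B x ≤ C) (n i : ℕ)
    {V : Set ℝ} (hV : MeasurableSet V) :
    (dualOp f B)^[n] (Measure.dirac 0) ((fun x => x i) ⁻¹' V) ≤
      (ENNReal.ofReal (Real.exp C) • apriori f + Measure.dirac 0 : Measure ℝ) V := by
  have hmeas : ∀ j : ℕ, MeasurableSet ((fun x : ℕ → ℝ => x j) ⁻¹' V) := fun j =>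
    measurable_pi_apply j hV
  induction n generalizing i with
  | zero =>
    rw [Function.iterate_zero_apply, Measure.dirac_apply' _ (hmeas i), Measure.add_apply,
      Measure.dirac_apply' _ hV]
    exact le_add_left le_rfl
  | succ n ih =>
    have := isProbabilityMeasure_dualOp_iterate hB hB1 (Measure.dirac 0) n
    rw [Function.iterate_succ_apply', ← lintegral_indicator_one (hmeas i),
      lintegral_dualOp hB.1 _ (measurable_one.indicator (hmeas i))]
    -- The newest coordinate has density at most `exp C` against the a priori measure; every older
    -- coordinate keeps its law from the previous iterate, down to the Dirac mass at the start.
    cases i with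
    | zero =>
      calc _ ≤ ∫⁻ _, ENNReal.ofReal (Real.exp C) * apriori f V
            ∂((dualOp f B)^[n] (Measure.dirac 0)) := by
            refine lintegral_mono fun x => ?_
            rw [← lintegral_indicator_one hV,
              ← lintegral_const_mul _ (measurable_one.indicator hV)]
            refine lintegral_mono fun a => ?_
            gcongr
            · exact hC _
            · exact le_of_eq rfl
        _ = ENNReal.ofReal (Real.exp C) * apriori f V := by
            rw [lintegral_const, measure_univ, mul_one]
        _ ≤ _ := by
            rw [Measure.add_apply, Measure.smul_apply, smul_eq_mul]
            exact le_self_add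
    | succ i =>
      refine le_trans (le_of_eq ?_) (ih i)
      rw [← lintegral_indicator_one (hmeas i)]
      refine lintegral_congr fun x => ?_
      have h1 : ∀ a, ((fun x : ℕ → ℝ => x (i + 1)) ⁻¹' V).indicator (1 : (ℕ → ℝ) → ENNReal)
          (prepend a x) = ((fun x : ℕ → ℝ => x i) ⁻¹' V).indicator 1 x := fun a => rfl
      simp only [h1]
      have h2 : Measurable fun a => ENNReal.ofReal (Real.exp (B (prepend a x))) :=
        (Real.continuous_exp.comp (hB.1.comp (continuous_prepend_left x))).measurable.ennreal_ofReal
      rw [lintegral_mul_const _ h2, lintegral_exp_normalized hB hB1, one_mul]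

/-- Measures on sequences with uniformly dominated marginals form a tight set. -/
lemma isTightMeasureSet_of_marginal_le {S : Set (Measure (ℕ → ℝ))} (m : Measure ℝ)
    [IsFiniteMeasure m]
    (h : ∀ μ ∈ S, ∀ (i : ℕ) (V : Set ℝ), MeasurableSet V → μ ((fun x => x i) ⁻¹' V) ≤ m V) :
    IsTightMeasureSet S := by
  rw [isTightMeasureSet_iff_exists_isCompact_measure_compl_le]
  intro ε hε
  obtain ⟨δ, hδ, hsum⟩ := ENNReal.exists_pos_sum_of_countable' hε.ne' ℕ
  have hK : ∀ i, ∃ K : Set ℝ, IsCompact K ∧ m Kᶜ ≤ δ i := fun i => by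
    have := isTightMeasureSet_iff_exists_isCompact_measure_compl_le.1
      (isTightMeasureSet_singleton (μ := m)) (δ i) (hδ i)
    simpa using this
  choose K hKc hKm using hK
  refine ⟨Set.pi Set.univ K, isCompact_univ_pi hKc, fun μ hμ => ?_⟩
  have hsub : (Set.pi Set.univ K)ᶜ ⊆ ⋃ i, (fun x : ℕ → ℝ => x i) ⁻¹' (K i)ᶜ := fun x hx => by
    simpa [Set.mem_pi] using hx
  calc μ (Set.pi Set.univ K)ᶜ ≤ ∑' i, μ ((fun x : ℕ → ℝ => x i) ⁻¹' (K i)ᶜ) :=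
        (measure_mono hsub).trans (measure_iUnion_le _)
    _ ≤ ∑' i, δ i := ENNReal.tsum_le_tsum fun i =>
        (h μ hμ i _ (hKc i).measurableSet.compl).trans (hKm i)
    _ ≤ ε := hsum.le

/-- Tightness gives a cluster point of the dual iterates themselves, without Cesàro averages:
consecutive iterates of the operator on a Hölder function differ at `0` by a null sequence, so every
cluster point is fixed. -/
lemma exists_dualOp_fixed (hα : 0 < α) (hα1 : α ≤ 1) (hB : IsHolder α B)
    (hB1 : ∀ x, ruelleOp f B (fun _ => 1) x = 1) :
    ∃ μ : Measure (ℕ → ℝ), IsProbabilityMeasure μ ∧ dualOp f B μ = μ := by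
  have hBb := hB.isBddCont hα
  obtain ⟨C, hC⟩ := hBb.2
  have hprob := isProbabilityMeasure_dualOp_iterate (f := f) hBb hB1 (Measure.dirac 0)
  let p : ℕ → ProbabilityMeasure (ℕ → ℝ) := fun n => ⟨(dualOp f B)^[n] (Measure.dirac 0), hprob n⟩
  have htight : IsTightMeasureSet
      {((μ : ProbabilityMeasure (ℕ → ℝ)) : Measure (ℕ → ℝ)) | μ ∈ Set.range p} := by
    have : IsFiniteMeasure (ENNReal.ofReal (Real.exp C) • apriori f) :=
      Measure.smul_finite _ ENNReal.ofReal_ne_top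
    refine isTightMeasureSet_of_marginal_le
      (ENNReal.ofReal (Real.exp C) • apriori f + Measure.dirac 0) ?_
    rintro _ ⟨_, ⟨n, rfl⟩, rfl⟩ i V hV
    exact dualOp_iterate_apply_preimage_le hBb hB1 (fun x => (le_abs_self _).trans (hC x)) n i hV
  obtain ⟨μ, -, hμ⟩ := (isCompact_closure_of_isTightMeasureSet htight).exists_mapClusterPt
    (f := atTop) (u := p)
    (le_principal_iff.2 (mem_map.2 (Eventually.of_forall fun n => subset_closure ⟨n, rfl⟩)))
  obtain ⟨U, hU, hlim⟩ := mapClusterPt_iff_ultrafilter.1 hμ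
  have hint : ∀ {φ : (ℕ → ℝ) → ℝ}, IsBddCont φ →
      Tendsto (fun n => (ruelleOp f B)^[n] φ 0) U (𝓝 (∫ x, φ x ∂(μ : Measure (ℕ → ℝ)))) := by
    intro φ hφ
    obtain ⟨Φ, rfl⟩ := hφ.exists_coe
    have h1 := ProbabilityMeasure.tendsto_iff_forall_integral_tendsto.1 hlim Φ
    refine h1.congr fun n => ?_
    have h2 := integral_dualOp_iterate (f := f) hBb hB1 (Measure.dirac 0) hφ n
    rw [integral_dirac] at h2
    exact h2
  refine ⟨μ, inferInstance, ?_⟩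
  have := isProbabilityMeasure_dualOp (f := f) hBb hB1 (μ : Measure (ℕ → ℝ))
  refine ext_of_forall_isHolder hα hα1 fun φ hφ => ?_
  have hφb := hφ.isBddCont hα
  rw [integral_dualOp hBb _ hφb]
  obtain ⟨r, hr, hle⟩ := exists_tendsto_zero_abs_iterate_sub_le (f := f) hα hB hB1 hφ
  -- One more application averages `u` over preimages of `0`, which moves its value at `0` by no
  -- more than the oscillation of `u`.
  have hdiff : Tendsto (fun n => (ruelleOp f B)^[n] (ruelleOp f B φ) 0 - (ruelleOp f B)^[n] φ 0)
      atTop (𝓝 0) := by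
    refine squeeze_zero_norm (fun n => ?_) hr
    have hu := hBb.ruelleOp_iterate (f := f) hφb n
    set u := (ruelleOp f B)^[n] φ with hu_def
    have h1 : ruelleOp f B (fun _ => u 0) 0 = u 0 := by
      have := ruelleOp_const_mul (f := f) (A := B) (u 0) (fun _ => 1) 0
      rwa [hB1, mul_one] at this
    have h2 : (ruelleOp f B)^[n] (ruelleOp f B φ) 0 - u 0 =
        ruelleOp f B (fun y => u y - u 0) 0 := by
      rw [ruelleOp_sub hBb hu (isBddCont_const _), h1, hu_def, ← Function.iterate_succ_apply,
        Function.iterate_succ_apply']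
    rw [h2, Real.norm_eq_abs]
    refine (abs_ruelleOp_le _ _).trans ?_
    have h3 : ruelleOp f B (fun _ => r n * 1) 0 = r n := by
      rw [ruelleOp_const_mul, hB1, mul_one]
    rw [← h3]
    exact ruelleOp_mono hBb (hu.sub (isBddCont_const _)).abs (isBddCont_const _)
      (fun y => (hle n y 0).trans_eq (mul_one _).symm) 0
  have h1 := (hint (hBb.ruelleOp (f := f) hφb)).sub (hint hφb)
  exact sub_eq_zero.1 (tendsto_nhds_unique h1 (hdiff.mono_left hU))

/-- For a fixed measure the integral of `φ` is that of any iterate, hence within the oscillation `r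
n` of the value of that iterate at `0`, a number that does not involve the measure. -/
lemma dualOp_fixed_unique (hα : 0 < α) (hα1 : α ≤ 1) (hB : IsHolder α B)
    (hB1 : ∀ x, ruelleOp f B (fun _ => 1) x = 1) {μ ν : Measure (ℕ → ℝ)}
    [IsProbabilityMeasure μ] [IsProbabilityMeasure ν] (hμ : IsDualFixed f B μ)
    (hν : IsDualFixed f B ν) : μ = ν := by
  have hBb := hB.isBddCont hα
  refine ext_of_forall_isHolder hα hα1 fun φ hφ => ?_
  have hφb := hφ.isBddCont hα
  have hiter : ∀ {m : Measure (ℕ → ℝ)}, IsDualFixed f B m → ∀ n : ℕ,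
      ∫ x, φ x ∂m = ∫ x, (ruelleOp f B)^[n] φ x ∂m := by
    intro m hm n
    induction n with
    | zero => rfl
    | succ n ih =>
      obtain ⟨Φ, hΦ⟩ := (hBb.ruelleOp_iterate (f := f) hφb n).exists_coe
      have := hm Φ
      rw [hΦ] at this
      rw [ih, this]
      simp only [Function.iterate_succ_apply']
  obtain ⟨r, hr, hle⟩ := exists_tendsto_zero_abs_iterate_sub_le (f := f) hα hB hB1 hφ
  have hnear : ∀ {m : Measure (ℕ → ℝ)} [IsProbabilityMeasure m], IsDualFixed f B m → ∀ n : ℕ,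
      |∫ x, φ x ∂m - (ruelleOp f B)^[n] φ 0| ≤ r n := by
    intro m _ hm n
    have hu := (hBb.ruelleOp_iterate (f := f) hφb n).integrable m
    have h1 : ∫ x, φ x ∂m - (ruelleOp f B)^[n] φ 0 =
        ∫ x, ((ruelleOp f B)^[n] φ x - (ruelleOp f B)^[n] φ 0) ∂m := by
      rw [integral_sub hu (integrable_const _), ← hiter hm n]
      simp
    rw [h1]
    have h2 := norm_integral_le_of_norm_le_const (μ := m)
      (f := fun x => (ruelleOp f B)^[n] φ x - (ruelleOp f B)^[n] φ 0)
      (ae_of_all _ fun x => hle n x 0)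
    simpa using h2
  have hb : ∀ n, |∫ x, φ x ∂μ - ∫ x, φ x ∂ν| ≤ r n + r n := fun n => by
    have h1 := abs_le.1 (hnear hμ n)
    have h2 := abs_le.1 (hnear hν n)
    rw [abs_le]
    constructor <;> linarith
  have hlim := hr.add hr
  rw [add_zero] at hlim
  exact sub_eq_zero.1 (abs_nonpos_iff.1 (ge_of_tendsto' hlim hb))

end Dual

/-- The operator sends `φ ∘ shift` to `φ` times the image of `1`, which is `φ` itself. -/
lemma IsDualFixed.map_shift {f : ℝ → ℝ} {B : (ℕ → ℝ) → ℝ}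
    (hB1 : ∀ x, ruelleOp f B (fun _ => 1) x = 1)
    {μ : Measure (ℕ → ℝ)} [IsProbabilityMeasure μ] (hμ : IsDualFixed f B μ) :
    μ.map shift = μ := by
  have := Measure.isProbabilityMeasure_map (μ := μ) continuous_shift.aemeasurable
  refine ext_of_forall_integral_eq_of_IsFiniteMeasure fun φ => ?_
  rw [integral_map continuous_shift.aemeasurable φ.continuous.aestronglyMeasurable]
  have h := hμ (φ.compContinuous ⟨shift, continuous_shift⟩)
  refine h.trans (integral_congr_ae (ae_of_all _ fun x => ?_))
  have h2 := ruelleOp_const_mul (f := f) (A := B) (φ x) (fun _ => 1) x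
  rw [hB1] at h2
  simpa [ruelleOp, shift_prepend] using h2

/-! ### Extended integrals -/

section ExtIntegral

variable {μ : Measure (ℕ → ℝ)} {g : (ℕ → ℝ) → ℝ}

lemma lintegral_ofReal_ne_top (hg : Integrable g μ) : ∫⁻ x, ENNReal.ofReal (g x) ∂μ ≠ ⊤ :=
  ne_top_of_le_ne_top ((hasFiniteIntegral_iff_norm g).1 hg.2).ne
    (lintegral_mono fun x => ENNReal.ofReal_le_ofReal (le_abs_self (g x)))

lemma extIntegral_eq_integral (hg : Integrable g μ) :
    extIntegral μ g = ((∫ x, g x ∂μ : ℝ) : EReal) := by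
  have h1 := lintegral_ofReal_ne_top hg
  have h2 := lintegral_ofReal_ne_top (μ := μ) (g := fun x => -g x) hg.neg
  rw [integral_eq_lintegral_pos_part_sub_lintegral_neg_part hg, extIntegral, EReal.coe_sub,
    EReal.coe_ennreal_toReal h1, EReal.coe_ennreal_toReal h2]

lemma integrable_of_lintegral_ofReal_ne_top (hm : AEStronglyMeasurable g μ)
    (h1 : ∫⁻ x, ENNReal.ofReal (g x) ∂μ ≠ ⊤) (h2 : ∫⁻ x, ENNReal.ofReal (-g x) ∂μ ≠ ⊤) :
    Integrable g μ := by
  refine ⟨hm, (hasFiniteIntegral_iff_norm g).2 ?_⟩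
  have hle : ∀ x, ENNReal.ofReal ‖g x‖ ≤ ENNReal.ofReal (g x) + ENNReal.ofReal (-g x) :=
    fun x => by
    rw [Real.norm_eq_abs]
    rcases abs_cases (g x) with ⟨h, -⟩ | ⟨h, -⟩ <;> rw [h]
    · exact le_self_add
    · exact le_add_self
  refine (lintegral_mono hle).trans_lt ?_
  rw [lintegral_add_left' hm.aemeasurable.ennreal_ofReal]
  exact ENNReal.add_lt_top.2 ⟨h1.lt_top, h2.lt_top⟩

end ExtIntegral

/-! ### Jensen's inequality for a normalized Ruelle operator -/

lemma IsBddCont.log {φ : (ℕ → ℝ) → ℝ} (hφ : IsBddCont φ) {ε : ℝ} (hε : 0 < ε)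
    (h : ∀ x, ε ≤ φ x) : IsBddCont fun x => Real.log (φ x) := by
  obtain ⟨C, hC⟩ := hφ.2
  refine ⟨hφ.1.log fun x => (hε.trans_le (h x)).ne', max |Real.log ε| |Real.log C|, fun x => ?_⟩
  exact abs_le_max_abs_abs (Real.log_le_log hε (h x))
    (Real.log_le_log (hε.trans_le (h x)) ((le_abs_self _).trans (hC x)))

/-- Adding the same positive number to `p` and `q` moves their quotient towards 1. This dominates
the positive parts uniformly in `ε` when strictly positive functions are approximated by functions
bounded away from zero. -/
lemma log_add_sub_log_add_le {p q ε : ℝ} (hp : 0 < p) (hq : 0 < q) (hε : 0 < ε) :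
    Real.log (p + ε) - Real.log (q + ε) ≤ max (Real.log p - Real.log q) 0 := by
  rcases le_total p q with h | h
  · refine le_max_of_le_right (sub_nonpos.2 (Real.log_le_log (by linarith) (by linarith)))
  · refine le_max_of_le_left ?_
    rw [← Real.log_div (by linarith) (by linarith), ← Real.log_div hp.ne' hq.ne']
    refine Real.log_le_log (by positivity) ?_
    rw [div_le_div_iff₀ (by linarith) hq]
    nlinarith

/-! ### The entropy -/

/-- The test function `u = exp B` turns the operator of the zero potential on `u` into that of `B`
on `1`, so the logarithmic ratio is exactly `-B`. -/
lemma entropy_le_neg_integral {f : ℝ → ℝ} {B : (ℕ → ℝ) → ℝ} (hB : IsBddCont B)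
    (hB1 : ∀ x, ruelleOp f B (fun _ => 1) x = 1)
    (μ : Measure (ℕ → ℝ)) [IsProbabilityMeasure μ] :
    entropy f μ ≤ ((-∫ x, B x ∂μ : ℝ) : EReal) := by
  obtain ⟨u, hu⟩ := hB.exp.exists_coe
  have hratio : logRatio f u = fun x => -B x := by
    funext x
    have h1 : ruelleOp f (fun _ => 0) u x = 1 := by
      rw [← hB1 x, hu]
      simp [ruelleOp]
    rw [logRatio, h1, hu, one_div, Real.log_inv, Real.log_exp]
  have hint : Integrable (fun x => -B x) μ := hB.neg.integrable μ
  have hle := iInf_le_of_le (f := fun u : (ℕ → ℝ) →ᵇ ℝ => ⨅ (_ : ∀ x, 0 < u x)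
    (_ : HasExtIntegral μ (logRatio f u)), extIntegral μ (logRatio f u)) u
    (iInf_le_of_le (fun x => by rw [hu]; exact Real.exp_pos _)
      (iInf_le_of_le (Or.inl (by rw [hratio]; exact lintegral_ofReal_ne_top hint)) le_rfl))
  refine hle.trans_eq ?_
  rw [hratio, extIntegral_eq_integral hint, integral_neg]

/-! ### Jensen's inequality and the lower bound for the entropy of a dual fixed point -/

section Jensen

variable {f : ℝ → ℝ} [IsProbabilityMeasure (apriori f)] {B : (ℕ → ℝ) → ℝ}

lemma ruelleOp_log_le (hB : IsBddCont B) (hB1 : ∀ x, ruelleOp f B (fun _ => 1) x = 1)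
    {v : (ℕ → ℝ) → ℝ} (hv : IsBddCont v) {ε : ℝ} (hε : 0 < ε) (hvε : ∀ x, ε ≤ v x)
    (x : ℕ → ℝ) : ruelleOp f B (fun y => Real.log (v y)) x ≤ Real.log (ruelleOp f B v x) := by
  have hpos : ∀ y, 0 < v y := fun y => hε.trans_le (hvε y)
  set s := ruelleOp f B v x with hs
  have hs0 : 0 < s := ruelleOp_pos hB hv hpos x
  have h1 := ruelleOp_mono (f := f) hB (hv.log hε hvε)
    -- The tangent line of the logarithm at the mean `s` lies above it; averaging the line gives
    -- `log s`.
    ((hv.const_mul s⁻¹).add ((isBddCont_const 1).const_mul (Real.log s - 1))) (fun y => by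
      have := Real.log_le_sub_one_of_pos (mul_pos (inv_pos.2 hs0) (hpos y))
      rw [Real.log_mul (inv_pos.2 hs0).ne' (hpos y).ne', Real.log_inv] at this
      linarith) x
  rw [ruelleOp_add hB (hv.const_mul _) ((isBddCont_const 1).const_mul _), ruelleOp_const_mul,
    ruelleOp_const_mul, hB1, ← hs, inv_mul_cancel₀ hs0.ne'] at h1
  linarith

lemma integral_log_le_of_isDualFixed (hB : IsBddCont B)
    (hB1 : ∀ x, ruelleOp f B (fun _ => 1) x = 1) {μ : Measure (ℕ → ℝ)} [IsProbabilityMeasure μ]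
    (hμ : IsDualFixed f B μ) {v : (ℕ → ℝ) → ℝ} (hv : IsBddCont v) {ε : ℝ} (hε : 0 < ε)
    (hvε : ∀ x, ε ≤ v x) :
    IsBddCont (fun x => Real.log (ruelleOp f B v x)) ∧
      ∫ x, Real.log (v x) ∂μ ≤ ∫ x, Real.log (ruelleOp f B v x) ∂μ := by
  have hlow : ∀ x, ε ≤ ruelleOp f B v x := fun x => by
    have h1 := ruelleOp_mono (f := f) hB ((isBddCont_const 1).const_mul ε) hv
      (fun y => by simpa using hvε y) x
    rwa [ruelleOp_const_mul, hB1, mul_one] at h1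
  have hb : IsBddCont fun x => Real.log (ruelleOp f B v x) := (hB.ruelleOp hv).log hε hlow
  have hl := hv.log hε hvε
  refine ⟨hb, ?_⟩
  obtain ⟨Φ, hΦ⟩ := hl.exists_coe
  have h1 := hμ Φ
  rw [hΦ] at h1
  rw [h1]
  exact integral_mono ((hB.ruelleOp hl).integrable μ) (hb.integrable μ)
    fun x => ruelleOp_log_le hB hB1 hv hε hvε x

/-- The negative part of `log (P v) - log v` has at most the integral of the positive part, for
the normalized operator `P` and a measure fixed by its dual. -/
lemma lintegral_neg_log_le_of_isDualFixed (hB : IsBddCont B)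
    (hB1 : ∀ x, ruelleOp f B (fun _ => 1) x = 1) {μ : Measure (ℕ → ℝ)} [IsProbabilityMeasure μ]
    (hμ : IsDualFixed f B μ) {v : (ℕ → ℝ) → ℝ} (hv : IsBddCont v) (hpos : ∀ x, 0 < v x) :
    ∫⁻ x, ENNReal.ofReal (-(Real.log (ruelleOp f B v x) - Real.log (v x))) ∂μ ≤
      ∫⁻ x, ENNReal.ofReal (Real.log (ruelleOp f B v x) - Real.log (v x)) ∂μ := by
  have hPpos := ruelleOp_pos (f := f) hB hv hpos
  set p := ruelleOp f B v with hp
  have hPb : IsBddCont p := hB.ruelleOp hv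
  -- As `v` need not be bounded away from zero, its logarithm may fail to be integrable. Jensen is
  -- applied to `v + ε n`, whose image is `p + ε n`, and Fatou's lemma passes to the limit in the
  -- negative parts.
  let ε : ℕ → ℝ := fun n => 1 / ((n : ℝ) + 1)
  have hε : ∀ n, 0 < ε n := fun n => by positivity
  have hεlim : Tendsto ε atTop (𝓝 0) := tendsto_one_div_add_atTop_nhds_zero_nat
  let w : ℕ → (ℕ → ℝ) → ℝ := fun n x => Real.log (p x + ε n) - Real.log (v x + ε n)
  have hP : ∀ n x, ruelleOp f B (fun y => v y + ε n) x = p x + ε n := fun n x => by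
    have h1 := ruelleOp_add (f := f) hB hv ((isBddCont_const 1).const_mul (ε n)) x
    rw [ruelleOp_const_mul, hB1, ← hp] at h1
    simpa using h1
  have hwb : ∀ n, IsBddCont (w n) := fun n =>
    ((hPb.add (isBddCont_const (ε n))).log (hε n) fun x => by linarith [hPpos x]).sub
      ((hv.add (isBddCont_const (ε n))).log (hε n) fun x => by linarith [hpos x])
  have hbound : ∀ n, ∫⁻ x, ENNReal.ofReal (-w n x) ∂μ ≤
      ∫⁻ x, ENNReal.ofReal (Real.log (p x) - Real.log (v x)) ∂μ := by
    intro n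
    have hvε : ∀ x, ε n ≤ v x + ε n := fun x => by linarith [hpos x]
    have hve := hv.add (isBddCont_const (ε n))
    obtain ⟨h1, h2⟩ := integral_log_le_of_isDualFixed hB hB1 hμ hve (hε n) hvε
    have hwi := (hwb n).integrable μ
    have h0 : 0 ≤ ∫ x, w n x ∂μ := by
      have h3 : ∀ x, w n x =
          Real.log (ruelleOp f B (fun y => v y + ε n) x) - Real.log (v x + ε n) := fun x => by
        rw [hP]
      simp only [h3]
      rw [integral_sub (h1.integrable μ) ((hve.log (hε n) hvε).integrable μ)]
      linarith
    rw [integral_eq_lintegral_pos_part_sub_lintegral_neg_part hwi, sub_nonneg] at h0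
    have h4 : ∫⁻ x, ENNReal.ofReal (-w n x) ∂μ ≤ ∫⁻ x, ENNReal.ofReal (w n x) ∂μ :=
      (ENNReal.toReal_le_toReal (lintegral_ofReal_ne_top (g := fun x => -w n x) hwi.neg)
        (lintegral_ofReal_ne_top hwi)).1 h0
    refine h4.trans (lintegral_mono fun x => ?_)
    have h5 := log_add_sub_log_add_le (hPpos x) (hpos x) (hε n)
    refine (ENNReal.ofReal_le_ofReal h5).trans_eq ?_
    rw [ENNReal.ofReal_max, ENNReal.ofReal_zero, max_eq_left zero_le]
  have hlim : ∀ x, Tendsto (fun n => ENNReal.ofReal (-w n x)) atTop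
      (𝓝 (ENNReal.ofReal (-(Real.log (p x) - Real.log (v x))))) := by
    intro x
    refine ENNReal.tendsto_ofReal (Tendsto.neg (Tendsto.sub ?_ ?_))
    · refine Tendsto.log ?_ (hPpos x).ne'
      simpa using hεlim.const_add (p x)
    · refine Tendsto.log ?_ (hpos x).ne'
      simpa using hεlim.const_add (v x)
  calc ∫⁻ x, ENNReal.ofReal (-(Real.log (p x) - Real.log (v x))) ∂μ
      = ∫⁻ x, liminf (fun n => ENNReal.ofReal (-w n x)) atTop ∂μ :=
        lintegral_congr fun x => (hlim x).liminf_eq.symm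
    _ ≤ liminf (fun n => ∫⁻ x, ENNReal.ofReal (-w n x) ∂μ) atTop :=
        lintegral_liminf_le fun n => (hwb n).1.measurable.neg.ennreal_ofReal
    _ ≤ liminf (fun _ : ℕ => ∫⁻ x, ENNReal.ofReal (Real.log (p x) - Real.log (v x)) ∂μ) atTop :=
        liminf_le_liminf (Eventually.of_forall hbound)
    _ = _ := liminf_const _

/-- With `v = exp (-B) * u` the logarithmic ratio becomes `log (P v) - log v - B`, where `P` is the
operator of `B`, and the first difference has nonnegative integral by Jensen and the invariance of
the measure under the dual. -/
lemma IsDualFixed.neg_integral_le_entropy (hB : IsBddCont B)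
    (hB1 : ∀ x, ruelleOp f B (fun _ => 1) x = 1) {μ : Measure (ℕ → ℝ)} [IsProbabilityMeasure μ]
    (hμ : IsDualFixed f B μ) : ((-∫ x, B x ∂μ : ℝ) : EReal) ≤ entropy f μ := by
  refine le_iInf fun u => le_iInf fun hu => le_iInf fun hext => ?_
  have hub := isBddCont_coe u
  set v : (ℕ → ℝ) → ℝ := fun x => Real.exp (-B x) * u x with hv_def
  have hv : IsBddCont v := hB.neg.exp.mul hub
  have hvpos : ∀ x, 0 < v x := fun x => mul_pos (Real.exp_pos _) (hu x)
  have hPv : ∀ x, ruelleOp f (fun _ => 0) u x = ruelleOp f B v x := fun x => by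
    unfold ruelleOp
    congr 1 with a
    rw [hv_def, ← mul_assoc, ← Real.exp_add, add_neg_cancel]
  have hPpos := ruelleOp_pos (f := f) hB hv hvpos
  set w : (ℕ → ℝ) → ℝ := fun x => Real.log (ruelleOp f B v x) - Real.log (v x) with hw
  have hratio : logRatio f u = fun x => w x - B x := by
    funext x
    have h1 : Real.log (v x) = -B x + Real.log (u x) := by
      rw [hv_def, Real.log_mul (Real.exp_pos _).ne' (hu x).ne', Real.log_exp]
    rw [logRatio, hPv, Real.log_div (hPpos x).ne' (hu x).ne']
    simp only [hw, h1]
    ring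
  have hwm : Continuous w :=
    ((hB.ruelleOp hv).1.log fun x => (hPpos x).ne').sub (hv.1.log fun x => (hvpos x).ne')
  have hkey : ∫⁻ x, ENNReal.ofReal (-w x) ∂μ ≤ ∫⁻ x, ENNReal.ofReal (w x) ∂μ :=
    lintegral_neg_log_le_of_isDualFixed hB hB1 hμ hv hvpos
  -- If the positive part has infinite integral, the existence of the integral makes it `⊤`.
  -- Otherwise the comparison `hkey` makes `w` integrable.
  by_cases htop : ∫⁻ x, ENNReal.ofReal (logRatio f u x) ∂μ = ⊤
  · have hneg : ∫⁻ x, ENNReal.ofReal (-logRatio f u x) ∂μ ≠ ⊤ :=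
      hext.resolve_left (not_not.2 htop)
    rw [extIntegral, htop, ← ENNReal.ofReal_toReal hneg,
      EReal.coe_ennreal_ofReal, max_eq_left ENNReal.toReal_nonneg, EReal.coe_ennreal_top,
      EReal.top_sub_coe]
    exact le_top
  · have hBi := hB.integrable μ
    have hw1 : ∫⁻ x, ENNReal.ofReal (w x) ∂μ ≠ ⊤ := by
      refine ne_top_of_le_ne_top (ENNReal.add_ne_top.2 ⟨htop, lintegral_ofReal_ne_top hBi⟩) ?_
      rw [← lintegral_add_right _ hB.1.measurable.ennreal_ofReal]
      refine lintegral_mono fun x => ?_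
      refine le_trans (le_of_eq ?_) ENNReal.ofReal_add_le
      rw [hratio]
      ring_nf
    have hwi : Integrable w μ := integrable_of_lintegral_ofReal_ne_top
      hwm.aestronglyMeasurable hw1 (ne_top_of_le_ne_top hw1 hkey)
    have hw0 : 0 ≤ ∫ x, w x ∂μ := by
      rw [integral_eq_lintegral_pos_part_sub_lintegral_neg_part hwi, sub_nonneg]
      exact ENNReal.toReal_mono hw1 hkey
    rw [hratio, extIntegral_eq_integral (g := fun x => w x - B x) (hwi.sub hBi),
      EReal.coe_le_coe_iff, integral_sub hwi hBi]
    linarith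

end Jensen

/-- The coboundary `log ψ - log (ψ ∘ shift)` has zero integral against an invariant measure. -/
lemma IsInvariantProb.integral_normalized {μ : Measure (ℕ → ℝ)} (hμ : IsInvariantProb μ)
    {α K : ℝ} (hα : 0 < α) {A ψ : (ℕ → ℝ) → ℝ} (hA : IsHolder α A) (hψ : InCone α K ψ)
    (lam : ℝ) : ∫ x, normalized A lam ψ x ∂μ = ∫ x, A x ∂μ - Real.log lam := by
  have := hμ.prob
  have hl := hψ.isHolder_log.isBddCont hα
  have hAb := hA.isBddCont hα
  have hs : ∫ x, Real.log (ψ (shift x)) ∂μ = ∫ x, Real.log (ψ x) ∂μ := by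
    conv_rhs => rw [← hμ.invariant]
    rw [integral_map continuous_shift.aemeasurable hl.1.aestronglyMeasurable]
  have hAl := hAb.add hl
  have hls := hl.comp continuous_shift
  unfold normalized
  rw [integral_sub ((hAl.sub hls).integrable μ) (integrable_const _),
    integral_sub (hAl.integrable μ) (hls.integrable μ),
    integral_add (hAb.integrable μ) (hl.integrable μ), hs]
  simp

/-! ### Existence and uniqueness of the Gibbs state, and the variational principle -/

section Pressure

variable {f : ℝ → ℝ} [IsProbabilityMeasure (apriori f)] {A : (ℕ → ℝ) → ℝ} {α : ℝ}

lemma exists_inCone_eigenpair (hα : 0 < α) (hA : IsHolder α A) :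
    ∃ (K lam : ℝ) (ψ : (ℕ → ℝ) → ℝ), 0 ≤ K ∧ InCone α K ψ ∧ IsPositiveEigenpair f α A lam ψ ∧
      IsMaximalEigenvalue f α A lam := by
  obtain ⟨C, hC0, hC⟩ := hA.exists_nonneg
  obtain ⟨K, hK⟩ := exists_absorbs hα hC0
  obtain ⟨lam, ψ, hlam, hψ, heig⟩ := exists_inCone_eigenfunction (f := f) hα hC hK
  exact ⟨K, lam, ψ, hK.1.le, hψ, ⟨hlam, hψ.isHolder hα hK.1.le, hψ.pos, heig⟩,
    isMaximalEigenvalue_of_inCone hα hA hK.1.le hlam hψ heig⟩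

/-- The Gibbs states are the invariant probability measures fixed by the dual of the Ruelle
operator of any one normalized potential. -/
lemma isGibbsState_iff (hα : 0 < α) (hA : IsHolder α A) {K lam : ℝ} (hK : 0 ≤ K)
    {ψ : (ℕ → ℝ) → ℝ} (hc : InCone α K ψ) (hψ : IsPositiveEigenpair f α A lam ψ)
    (hmax : IsMaximalEigenvalue f α A lam) (μ : Measure (ℕ → ℝ)) :
    IsGibbsState f α A μ ↔ IsInvariantProb μ ∧ IsDualFixed f (normalized A lam ψ) μ := by
  refine ⟨fun ⟨hinv, lam', ψ', hmax', hψ', hfix⟩ => ⟨hinv, ?_⟩,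
    fun ⟨hinv, hfix⟩ => ⟨hinv, lam, ψ, hmax, hψ, hfix⟩⟩
  obtain rfl := hmax'.unique hα hmax
  rwa [normalized_eq_of_eigenpair hα hA hK hc hψ hψ'] at hfix

lemma existsUnique_isGibbsState (hα : 0 < α) (hA : IsHolder α A) :
    ∃! μ : Measure (ℕ → ℝ), IsGibbsState f α A μ := by
  obtain ⟨K, lam, ψ, hK, hc, hψ, hmax⟩ := exists_inCone_eigenpair (f := f) hα hA
  -- For `α > 1` the coordinate arctangents are no longer `α`-Hölder. The measure theory is
  -- therefore done with exponent `min α 1`, for which the normalized potential is still Hölder.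
  have hβ : 0 < min α 1 := lt_min hα one_pos
  have hB := (hc.isHolder_normalized hα hA lam).mono hβ (min_le_left α 1)
  have hB1 := hψ.ruelleOp_normalized_one
  simp only [isGibbsState_iff hα hA hK hc hψ hmax]
  obtain ⟨μ, hprob, hμ⟩ := exists_dualOp_fixed (f := f) hβ (min_le_right α 1) hB hB1
  have hfix : IsDualFixed f (normalized A lam ψ) μ := fun φ => by
    rw [← integral_dualOp (hB.isBddCont hβ) μ (isBddCont_coe φ), hμ]
  refine ⟨μ, ⟨⟨hprob, hfix.map_shift hB1⟩, hfix⟩, fun ν hν => ?_⟩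
  have := hν.1.prob
  exact dualOp_fixed_unique hβ (min_le_right α 1) hB hB1 hν.2 hfix

lemma entropy_add_integral_le (hα : 0 < α) (hA : IsHolder α A) {lam : ℝ}
    (hlam : IsMaximalEigenvalue f α A lam) {μ : Measure (ℕ → ℝ)} (hμ : IsInvariantProb μ) :
    entropy f μ + ((∫ x, A x ∂μ : ℝ) : EReal) ≤ ((Real.log lam : ℝ) : EReal) := by
  obtain ⟨K, lam', ψ, hK, hc, hψ, hmax⟩ := exists_inCone_eigenpair (f := f) hα hA
  obtain rfl := hlam.unique hα hmax
  have := hμ.prob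
  have h := entropy_le_neg_integral ((hc.isHolder_normalized hα hA lam).isBddCont hα)
    hψ.ruelleOp_normalized_one μ
  rw [hμ.integral_normalized hα hA hc] at h
  refine (add_le_add_left h _).trans_eq ?_
  rw [← EReal.coe_add]
  ring_nf

lemma IsGibbsState.log_le_entropy_add_integral (hα : 0 < α) (hA : IsHolder α A) {lam : ℝ}
    (hlam : IsMaximalEigenvalue f α A lam) {μ : Measure (ℕ → ℝ)} (hμ : IsGibbsState f α A μ) :
    ((Real.log lam : ℝ) : EReal) ≤ entropy f μ + ((∫ x, A x ∂μ : ℝ) : EReal) := by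
  obtain ⟨K, lam', ψ, hK, hc, hψ, hmax⟩ := exists_inCone_eigenpair (f := f) hα hA
  obtain rfl := hlam.unique hα hmax
  obtain ⟨hinv, hfix⟩ := (isGibbsState_iff hα hA hK hc hψ hmax μ).1 hμ
  have := hinv.prob
  have h := hfix.neg_integral_le_entropy ((hc.isHolder_normalized hα hA lam).isBddCont hα)
    hψ.ruelleOp_normalized_one
  rw [hinv.integral_normalized hα hA hc] at h
  refine le_trans (le_of_eq ?_) (add_le_add_left h _)
  rw [← EReal.coe_add]
  ring_nf

end Pressure

end Ruelle

theorem mainTheorem2 (f : ℝ → ℝ) (hf : Continuous f) (hf_pos : ∀ a, 0 < f a)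
    (hf_int : ∫ a, f a = 1) (α : ℝ) (hα : 0 < α) (A : (ℕ → ℝ) → ℝ)
    (hA : Ruelle.IsHolder α A) :
    (∃! lam : ℝ, Ruelle.IsMaximalEigenvalue f α A lam) ∧
    (∃! μ : Measure (ℕ → ℝ), Ruelle.IsGibbsState f α A μ) ∧
    ∀ (lam : ℝ) (μA : Measure (ℕ → ℝ)),
      Ruelle.IsMaximalEigenvalue f α A lam → Ruelle.IsGibbsState f α A μA →
        ((Real.log lam : ℝ) : EReal) =
            (⨆ (μ : Measure (ℕ → ℝ)) (_ : Ruelle.IsInvariantProb μ),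
              Ruelle.entropy f μ + ((∫ x, A x ∂μ : ℝ) : EReal)) ∧
        Ruelle.entropy f μA + ((∫ x, A x ∂μA : ℝ) : EReal) =
            (⨆ (μ : Measure (ℕ → ℝ)) (_ : Ruelle.IsInvariantProb μ),
              Ruelle.entropy f μ + ((∫ x, A x ∂μ : ℝ) : EReal)) := by
  have := Ruelle.isProbabilityMeasure_apriori hf_pos hf_int
  refine ⟨?_, Ruelle.existsUnique_isGibbsState hα hA, fun lam μA hlam hμA => ?_⟩
  · obtain ⟨_, lam, _, _, _, _, hmax⟩ := Ruelle.exists_inCone_eigenpair (f := f) hα hA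
    exact ⟨lam, hmax, fun lam' h => h.unique hα hmax⟩
  · have hle : (⨆ (μ : Measure (ℕ → ℝ)) (_ : Ruelle.IsInvariantProb μ),
        Ruelle.entropy f μ + ((∫ x, A x ∂μ : ℝ) : EReal)) ≤ ((Real.log lam : ℝ) : EReal) :=
      iSup₂_le fun μ hμ => Ruelle.entropy_add_integral_le hα hA hlam hμ
    have hge := hμA.log_le_entropy_add_integral hα hA hlam
    have hmem := le_iSup₂_of_le (f := fun (μ : Measure (ℕ → ℝ)) (_ : Ruelle.IsInvariantProb μ) =>
      Ruelle.entropy f μ + ((∫ x, A x ∂μ : ℝ) : EReal)) μA hμA.1 le_rfl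
    exact ⟨le_antisymm (hge.trans hmem) hle, le_antisymm hmem (hle.trans hge)⟩
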